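/- Let $n\ge 1$. A real $n\times n$ matrix $A$ is called an (expansive) dilation if all its complex eigenvalues $\lambda$ satisfy $|\lambda|>1$. A quasi-norm associated with $A$ is a Lebesgue measurable function $\rho:\mathbb R^n\to[0,\infty)$ such that $\rho(x)=0$ if and only if $x=0$, $\rho(Ax)=|\det A|\,\rho(x)$ for all $x$, and, for some constant $c$, $\rho(x+y)\le c(\rho(x)+\rho(y))$ for all $x,y$. Two quasi-norms $\rho_1,\rho_2$ are equivalent up to a linear transformation if there are $c>0$ and $S\in GL_n(\mathbb R)$ with $\frac1c\rho_1(x)\le\rho_2(Sx)\le c\rho_1(x)$ for all $x\in\mathbb R^n$; two dilations $A_1,A_2$ are equivalent up to a linear transformation if every quasi-norm associated with $A_1$ is equivalent up to a linear transformation to every quasi-norm associated with $A_2$. Consider parameters consisting of an integer $k$, positive integers $n_1,\dots,n_k$ with $n_1+\dots+n_k=n$, real numbers $1<\lambda_1<\dots<\lambda_k$ with $\lambda_1^{n_1}\cdots\lambda_k^{n_k}=2$ and, if $n\ge2$, $\lambda_k<2$ (if $n=1$, necessarily $k=1$ and $\lambda_1=2$), and partitions $\pi^i=(\pi^i_1\ge\dots\ge\pi^i_{m_i}\ge1)$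 of $n_i$ for $i=1,\dots,k$. Let $A(\lambda_1,\dots,\lambda_k;\pi^1,\dots,\pi^k)$ be the $n\times n$ block diagonal matrix consisting of Jordan blocks with eigenvalues $\lambda_i$ and sizes $\pi^i_j$, $1\le j\le m_i$, $1\le i\le k$. Then: 1. Every matrix $A(\lambda_1,\dots,\lambda_k;\pi^1,\dots,\pi^k)$ is a dilation. 2. Every dilation $A$ on $\mathbb R^n$ has an associated quasi-norm, and $A$ is equivalent up to a linear transformation to $A(\lambda_1,\dots,\lambda_k;\pi^1,\dots,\pi^k)$ for exactly one choice of the parameters. 3. For two distinct choices of the parameters, no quasi-norm associated with the first of the corresponding matrices is equivalent up to a linear transformation to a quasi-norm associated with the second; in particular, these dilations are not equivalent up to a linear transformation. -/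

import Mathlib

open scoped Matrix

/-- A real `n × n` matrix is an (expansive) dilation if every complex eigenvalue `z` of it
satisfies `|z| > 1`. -/
def IsDilation {n : ℕ} (A : Matrix (Fin n) (Fin n) ℝ) : Prop :=
  ∀ z ∈ spectrum ℂ (A.map Complex.ofReal), 1 < ‖z‖

/-- `ρ` is a homogeneous quasi-norm associated with the dilation `A`. `NullMeasurable` with
respect to `volume` is Lebesgue measurability. -/
structure IsHomogeneousQuasiNorm {n : ℕ} (A : Matrix (Fin n) (Fin n) ℝ)
    (ρ : (Fin n → ℝ) → ℝ) : Prop where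
  measurable : MeasureTheory.NullMeasurable ρ MeasureTheory.volume
  nonneg : ∀ x, 0 ≤ ρ x
  eq_zero_iff : ∀ x, ρ x = 0 ↔ x = 0
  homogeneous : ∀ x, ρ (A *ᵥ x) = |A.det| * ρ x
  quasi_triangle : ∃ c : ℝ, ∀ x y, ρ (x + y) ≤ c * (ρ x + ρ y)

/-- Two quasi-norms are equivalent up to a linear transformation. -/
def QuasiNormEquivUpToLinear {n : ℕ} (ρ₁ ρ₂ : (Fin n → ℝ) → ℝ) : Prop :=
  ∃ c : ℝ, 0 < c ∧ ∃ S : GL (Fin n) ℝ, ∀ x : Fin n → ℝ,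
    1 / c * ρ₁ x ≤ ρ₂ ((S : Matrix (Fin n) (Fin n) ℝ) *ᵥ x) ∧
      ρ₂ ((S : Matrix (Fin n) (Fin n) ℝ) *ᵥ x) ≤ c * ρ₁ x

/-- Two dilations are equivalent up to a linear transformation: whichever associated quasi-norms
are chosen, these are equivalent up to a linear transformation. -/
def DilationEquivUpToLinear {n : ℕ} (A₁ A₂ : Matrix (Fin n) (Fin n) ℝ) : Prop :=
  ∀ ρ₁ ρ₂ : (Fin n → ℝ) → ℝ, IsHomogeneousQuasiNorm A₁ ρ₁ → IsHomogeneousQuasiNorm A₂ ρ₂ →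
    QuasiNormEquivUpToLinear ρ₁ ρ₂

/-- The `m × m` Jordan block with eigenvalue `a` and ones on the superdiagonal. -/
def jordanBlock (a : ℝ) (m : ℕ) : Matrix (Fin m) (Fin m) ℝ :=
  Matrix.of fun i j => if i = j then a else if (i : ℕ) + 1 = j then 1 else 0

/-- The block diagonal matrix with consecutive diagonal blocks `M 0, …, M (k - 1)`. -/
def blockDiag {k : ℕ} {d : Fin k → ℕ} (M : ∀ i, Matrix (Fin (d i)) (Fin (d i)) ℝ) :
    Matrix (Fin (∑ i, d i)) (Fin (∑ i, d i)) ℝ :=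
  Matrix.reindex finSigmaFinEquiv finSigmaFinEquiv (Matrix.blockDiagonal' M)

/-- The parts `π₁ ≥ … ≥ π_m` of a partition as a nonincreasing list. -/
def partsList {N : ℕ} (π : N.Partition) : List ℕ := π.parts.sort (· ≥ ·)

theorem sum_partsList {N : ℕ} (π : N.Partition) :
    ∑ j : Fin (partsList π).length, (partsList π).get j = N := by
  have h : (partsList π).sum = N := by
    have := congrArg Multiset.sum (Multiset.sort_eq π.parts (· ≥ ·))
    rw [Multiset.sum_coe, π.parts_sum] at this
    exact this
  conv_rhs => rw [← h]
  simp

/-- The parameters `λ₁ < … < λ_k`, `n₁, …, n_k ≥ 1`, `π¹, …, π^k` of the Jordan matrices.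
For `n ≥ 2` all `λ_i` lie in `(1, 2)`; for `n = 1` the product condition forces `λ₁ = 2`. -/
structure JordanParams (n : ℕ) where
  k : ℕ
  mult : Fin k → ℕ
  mult_pos : ∀ i, 0 < mult i
  sum_mult : ∑ i, mult i = n
  eig : Fin k → ℝ
  one_lt_eig : ∀ i, 1 < eig i
  eig_strictMono : StrictMono eig
  eig_lt_two : 2 ≤ n → ∀ i, eig i < 2
  prod_eig : ∏ i, eig i ^ mult i = 2
  part : ∀ i, (mult i).Partition

/-- The block diagonal matrix `A(λ₁, …, λ_k; π¹, …, π^k)` consisting of the Jordan blocks with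
eigenvalue `λ_i` and sizes `πⁱ_j`. -/
def JordanParams.matrix {n : ℕ} (p : JordanParams n) : Matrix (Fin n) (Fin n) ℝ :=
  have h : ∑ i, ∑ j, (partsList (p.part i)).get j = n := by
    simp only [sum_partsList, p.sum_mult]
  Matrix.reindex (finCongr h) (finCongr h)
    (blockDiag fun i => blockDiag fun j => jordanBlock (p.eig i) ((partsList (p.part i)).get j))

open scoped Matrix
open Filter Topology MeasureTheory Set

attribute [local instance] Matrix.linftyOpNormedAddCommGroup Matrix.linftyOpNormedSpace
  Matrix.linftyOpNormedRing Matrix.linftyOpNormedAlgebra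

/-! ### Powers of a dilation -/

variable {n : ℕ} {A B : Matrix (Fin n) (Fin n) ℝ}

/-! Up to constants, a quasi-norm of `A` only records the integer `k` for which `A ^ (-k)` brings a
nonzero vector into a fixed annulus. Measurability, through Steinhaus, makes every quasi-norm
bounded near the origin; homogeneity and the quasi-triangle inequality then bound it above and away
from zero on annuli. Equivalence thus becomes a question about matrices: a linear map `S` gives an
equivalence as soon as `B ^ (-m k) * S * A ^ k` and its inverse stay bounded for exponents `m k`
that match the determinants (`quasiNormEquivUpToLinear_of_bounded`). Conversely, for equal
determinants an equivalence bounds `B ^ (-k) * S * A ^ k` over all integers `k`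
(`QuasiNormEquivUpToLinear.exists_bounded`).

For existence of the parameters, write `A = S * (1 + N)` with `S` semisimple and `N` nilpotent,
commuting. Discarding the phases of the eigenvalues of `S` and taking the real power `s` with `|det
A| ^ s = 2` gives `Q = |S| ^ s * (1 + N) ^ s`, of determinant `2` and with real eigenvalues above
`1`. The products `A ^ a * Q ^ b` are bounded while `|a + s * b| ≤ s`, because the phases have
modulus one and only a bounded real exponent survives (`IsDilation.exists_bounded_zpow_mul_zpow`).
The real Jordan form of `Q` supplies the parameters.

For uniqueness, both matrices have determinant `2` and positive spectrum. A two-sided bounded orbit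
of `X ↦ B⁻¹ * X * A` is then constant, so `S * A = B * S` (`mul_eq_mul_of_bounded`): without phases,
boundedness leaves room neither for exponential nor for polynomial growth. Similar Jordan matrices
have the same parameters, as the ranks of `(A - a) ^ j` show. The step quasi-norm provides a
quasi-norm for every dilation, so that equivalence of dilations is never vacuous. -/

/-- Gelfand's formula: the `k`-th root of `‖B ^ k‖` tends to the spectral radius, so the powers
eventually decay geometrically. -/
theorem tendsto_pow_of_forall_spectrum_lt_one [NeZero n] {B : Matrix (Fin n) (Fin n) ℂ}
    (h : ∀ z ∈ spectrum ℂ B, ‖z‖ < 1) : Tendsto (fun k : ℕ => ‖B ^ k‖) atTop (𝓝 0) := by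
  have h1 : spectralRadius ℂ B < 1 := by
    have := spectrum.spectralRadius_lt_of_forall_lt B (r := 1) (fun z hz => by
      have := h z hz
      exact_mod_cast this)
    simpa using this
  obtain ⟨r, hr, hr1⟩ := ENNReal.lt_iff_exists_nnreal_btwn.mp h1
  have hr1' : (r : ℝ) < 1 := by exact_mod_cast hr1
  have h2 := (spectrum.pow_nnnorm_pow_one_div_tendsto_nhds_spectralRadius B).eventually_lt_const hr
  refine squeeze_zero' (Eventually.of_forall fun _ => norm_nonneg _) ?_
    (tendsto_pow_atTop_nhds_zero_of_lt_one r.2 hr1')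
  filter_upwards [h2, eventually_gt_atTop 0] with k hk hk0
  have h3 : ((‖B ^ k‖₊ : ENNReal) ^ (1 / k : ℝ)) ^ (k : ℝ) ≤ (r : ENNReal) ^ (k : ℝ) := by
    gcongr
  rw [← ENNReal.rpow_mul, one_div, inv_mul_cancel₀ (by positivity), ENNReal.rpow_one,
    ENNReal.rpow_natCast] at h3
  exact_mod_cast h3

/-- The operator norm for the sup norm is the maximal row sum of absolute values, which does not
notice the extension of scalars. -/
theorem norm_map_ofReal (A : Matrix (Fin n) (Fin n) ℝ) : ‖A.map Complex.ofReal‖ = ‖A‖ := by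
  simp [Matrix.linfty_opNorm_def]

theorem IsDilation.isUnit_det (hA : IsDilation A) : IsUnit A.det := by
  have h0 : (0 : ℂ) ∉ spectrum ℂ (A.map Complex.ofReal) := fun h => by
    have := hA 0 h
    norm_num at this
  rw [spectrum.zero_notMem_iff, Matrix.isUnit_iff_isUnit_det] at h0
  have : (A.map Complex.ofReal).det = ((A.det : ℝ) : ℂ) := (RingHom.map_det Complex.ofRealHom A).symm
  rw [this] at h0
  rw [isUnit_iff_ne_zero] at h0 ⊢
  exact_mod_cast h0

theorem IsDilation.tendsto_norm_inv_pow [NeZero n] (hA : IsDilation A) :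
    Tendsto (fun k : ℕ => ‖A ^ (-(k : ℤ))‖) atTop (𝓝 0) := by
  have hu := hA.isUnit_det
  have hc : (A.map Complex.ofReal) * (A⁻¹.map Complex.ofReal) = 1 := by
    have := congrArg (Complex.ofRealHom.mapMatrix) (Matrix.mul_nonsing_inv A hu)
    rw [map_mul, map_one] at this
    exact this
  have hc' := mul_eq_one_comm.mp hc
  let u : (Matrix (Fin n) (Fin n) ℂ)ˣ := ⟨_, _, hc, hc'⟩
  have h : ∀ z ∈ spectrum ℂ (A⁻¹.map Complex.ofReal), ‖z‖ < 1 := by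
    intro z hz
    have hz0 : z ≠ 0 := by
      rintro rfl
      rw [spectrum.zero_mem_iff] at hz
      exact hz u⁻¹.isUnit
    have h3 : (A⁻¹.map Complex.ofReal) = ↑u⁻¹ := rfl
    rw [h3, show z = ((Units.mk0 z hz0)⁻¹⁻¹ : ℂˣ) by simp, ← spectrum.inv_mem_iff] at hz
    have := hA _ hz
    simp at this
    exact (one_lt_inv₀ (norm_pos_iff.mpr hz0)).mp this
  refine (tendsto_pow_of_forall_spectrum_lt_one h).congr fun k => ?_
  rw [show (A⁻¹.map Complex.ofReal) ^ k = (A⁻¹ ^ k).map Complex.ofReal from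
    (map_pow (Complex.ofRealHom.mapMatrix) _ _).symm, norm_map_ofReal, Matrix.zpow_neg hu,
    zpow_natCast, Matrix.inv_pow']

theorem Multiset.one_lt_norm_prod {s : Multiset ℂ} (hs : s ≠ 0) (h : ∀ z ∈ s, 1 < ‖z‖) :
    1 < ‖s.prod‖ := by
  induction s using Multiset.induction_on with
  | empty => exact absurd rfl hs
  | cons a t ih =>
    rw [Multiset.prod_cons, norm_mul]
    have ha := h a (Multiset.mem_cons_self a t)
    rcases eq_or_ne t 0 with rfl | ht
    · simpa using ha
    · exact one_lt_mul_of_lt_of_le ha (ih ht fun z hz => h z (Multiset.mem_cons_of_mem hz)).le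

theorem IsDilation.one_lt_abs_det [NeZero n] (hA : IsDilation A) : 1 < |A.det| := by
  have h1 : (A.map Complex.ofReal).det = ((A.det : ℝ) : ℂ) :=
    (RingHom.map_det Complex.ofRealHom A).symm
  have h2 : |A.det| = ‖(A.map Complex.ofReal).det‖ := by simp [h1]
  rw [h2, Matrix.det_eq_prod_roots_charpoly]
  refine Multiset.one_lt_norm_prod (fun h => ?_) fun z hz => hA z ?_
  · have h3 := (IsAlgClosed.splits (A.map Complex.ofReal).charpoly).natDegree_eq_card_roots
    rw [h, Matrix.charpoly_natDegree_eq_dim, Fintype.card_fin] at h3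
    exact NeZero.ne n h3
  · exact Matrix.mem_spectrum_of_isRoot_charpoly (Polynomial.isRoot_of_mem_roots hz)

theorem IsDilation.exists_forall_norm_zpow_neg_lt [NeZero n] (hA : IsDilation A) {ε : ℝ}
    (hε : 0 < ε) : ∃ N : ℤ, ∀ k ≥ N, ‖A ^ (-k)‖ < ε := by
  obtain ⟨N, hN⟩ := eventually_atTop.mp (hA.tendsto_norm_inv_pow.eventually_lt_const hε)
  refine ⟨N, fun k hk => ?_⟩
  lift k to ℕ using by omega
  exact hN k (by omega)

theorem zpow_mulVec_zpow_mulVec (hA : IsUnit A.det) (j k : ℤ) (x : Fin n → ℝ) :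
    A ^ j *ᵥ (A ^ k *ᵥ x) = A ^ (j + k) *ᵥ x := by
  rw [Matrix.mulVec_mulVec, Matrix.zpow_add hA]

/-- Every nonzero orbit meets the annulus `1 ≤ ‖y‖ ≤ ‖A‖`: at the largest `k` with `1 ≤ ‖A ^ (-k) *ᵥ
x‖` the next iterate has norm below `1`, and `A` maps it back to the current one. -/
theorem IsDilation.exists_norm_zpow_neg_mulVec [NeZero n] (hA : IsDilation A) {x : Fin n → ℝ}
    (hx : x ≠ 0) : ∃ k : ℤ, 1 ≤ ‖A ^ (-k) *ᵥ x‖ ∧ ‖A ^ (-k) *ᵥ x‖ ≤ ‖A‖ := by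
  have hu := hA.isUnit_det
  have hx' : 0 < ‖x‖ := norm_pos_iff.mpr hx
  obtain ⟨N, hN⟩ := hA.exists_forall_norm_zpow_neg_lt (inv_pos.mpr hx')
  obtain ⟨M, hM⟩ := hA.exists_forall_norm_zpow_neg_lt hx'
  obtain ⟨k, hk, hk'⟩ := Int.exists_greatest_of_bdd (P := fun k => 1 ≤ ‖A ^ (-k) *ᵥ x‖)
    ⟨N, fun k hk => by
      by_contra! h
      have h1 := hN k h.le
      have h2 := Matrix.linfty_opNorm_mulVec (A ^ (-k)) x
      have h3 : ‖A ^ (-k)‖ * ‖x‖ < ‖x‖⁻¹ * ‖x‖ := by gcongr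
      rw [inv_mul_cancel₀ hx'.ne'] at h3
      linarith⟩
    ⟨-M, by
      have h1 := hM M le_rfl
      have h2 := Matrix.linfty_opNorm_mulVec (A ^ (-M)) (A ^ (- -M) *ᵥ x)
      rw [zpow_mulVec_zpow_mulVec hu, neg_neg, neg_add_cancel, zpow_zero, Matrix.one_mulVec] at h2
      rw [neg_neg]
      by_contra! h
      have : ‖A ^ (-M)‖ * ‖A ^ M *ᵥ x‖ ≤ ‖A ^ (-M)‖ * 1 := by gcongr
      linarith⟩
  refine ⟨k, hk, ?_⟩
  have h1 : ‖A ^ (-(k + 1)) *ᵥ x‖ < 1 := by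
    by_contra! h
    have := hk' _ h
    omega
  have h2 := Matrix.linfty_opNorm_mulVec A (A ^ (-(k + 1)) *ᵥ x)
  nth_rw 1 [← zpow_one A] at h2
  rw [zpow_mulVec_zpow_mulVec hu, show 1 + -(k + 1) = -k by ring] at h2
  exact h2.trans (by nlinarith [norm_nonneg A])

/-! ### Bounds for quasi-norms and the comparison criterion -/

namespace IsHomogeneousQuasiNorm

variable {ρ : (Fin n → ℝ) → ℝ}

theorem zpow (hA : IsUnit A.det) (hρ : IsHomogeneousQuasiNorm A ρ) (k : ℤ) (x : Fin n → ℝ) :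
    ρ (A ^ k *ᵥ x) = |A.det| ^ k * ρ x := by
  have hd : |A.det| ≠ 0 := abs_ne_zero.mpr hA.ne_zero
  induction k with
  | zero => simp
  | succ k ih =>
    rw [add_comm, ← zpow_mulVec_zpow_mulVec hA, zpow_one, hρ.homogeneous, ih, zpow_add₀ hd, zpow_one]
    ring
  | pred k ih =>
    have := hρ.homogeneous (A ^ (-(k : ℤ) - 1) *ᵥ x)
    nth_rw 1 [← zpow_one A] at this
    rw [zpow_mulVec_zpow_mulVec hA, show 1 + (-(k : ℤ) - 1) = -k by ring, ih] at this
    rw [zpow_sub_one₀ hd, mul_right_comm, this]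
    field_simp

theorem pos (hρ : IsHomogeneousQuasiNorm A ρ) {x : Fin n → ℝ} (hx : x ≠ 0) : 0 < ρ x :=
  lt_of_le_of_ne (hρ.nonneg x) fun h => hx ((hρ.eq_zero_iff x).mp h.symm)

/-- The Steinhaus theorem applied to a sublevel set of positive measure. -/
theorem exists_forall_mem_ball_le (hρ : IsHomogeneousQuasiNorm A ρ) :
    ∃ δ > 0, ∃ M, ∀ x : Fin n → ℝ, ‖x‖ < δ → ρ x ≤ M := by
  obtain ⟨c, hc⟩ := hρ.quasi_triangle
  -- The sublevel sets are made symmetric so that a difference `a - b` of two of their points can be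
  -- estimated as the sum `a + (-b)`.
  let E : ℕ → Set (Fin n → ℝ) := fun N => {x | ρ x ≤ N ∧ ρ (-x) ≤ N}
  have hneg : NullMeasurable (fun x => ρ (-x)) (volume : Measure (Fin n → ℝ)) :=
    hρ.measurable.comp_quasiMeasurePreserving
      (Measure.measurePreserving_neg volume).quasiMeasurePreserving
  have hE : ∀ N, NullMeasurableSet (E N) volume := fun N =>
    (hρ.measurable measurableSet_Iic).inter (hneg measurableSet_Iic)
  have hU : ⋃ N, E N = univ := by
    refine eq_univ_of_forall fun x => mem_iUnion.mpr ?_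
    obtain ⟨N, hN⟩ := exists_nat_ge (max (ρ x) (ρ (-x)))
    exact ⟨N, (le_max_left _ _).trans hN, (le_max_right _ _).trans hN⟩
  obtain ⟨N, hN⟩ : ∃ N, 0 < volume (E N) := by
    by_contra! h
    have : volume (⋃ N, E N) = 0 := measure_iUnion_null fun N => le_antisymm (h N) bot_le
    rw [hU] at this
    exact (NeZero.ne (volume : Measure (Fin n → ℝ))) (Measure.measure_univ_eq_zero.mp this)
  obtain ⟨F, hFE, hF, hFae⟩ := (hE N).exists_measurable_subset_ae_eq
  have hFpos : 0 < volume F := by rwa [measure_congr hFae]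
  obtain ⟨δ, hδ, hball⟩ := Metric.mem_nhds_iff.mp
    (Measure.sub_mem_nhds_zero_of_addHaar_pos volume F hF hFpos)
  refine ⟨δ, hδ, |c| * (N + N), fun x hx => ?_⟩
  obtain ⟨a, ha, b, hb, rfl⟩ := hball (mem_ball_zero_iff.mpr hx)
  have ha' := (hFE ha).1
  have hb' := (hFE hb).2
  have h0 := add_nonneg (hρ.nonneg a) (hρ.nonneg (-b))
  calc ρ (a - b) ≤ c * (ρ a + ρ (-b)) := by rw [sub_eq_add_neg]; exact hc _ _
    _ ≤ |c| * (ρ a + ρ (-b)) := by gcongr; exact le_abs_self c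
    _ ≤ |c| * (N + N) := by gcongr

/-- A fixed power `A ^ (-N)` shrinks the ball of radius `R` into the small ball where `ρ` is
bounded; homogeneity costs the factor `|A.det| ^ N`. -/
theorem exists_forall_norm_le_le [NeZero n] (hA : IsDilation A) (hρ : IsHomogeneousQuasiNorm A ρ)
    (R : ℝ) : ∃ M > 0, ∀ x : Fin n → ℝ, ‖x‖ ≤ R → ρ x ≤ M := by
  obtain ⟨δ, hδ, M, hM⟩ := hρ.exists_forall_mem_ball_le
  obtain ⟨N, hN⟩ := hA.exists_forall_norm_zpow_neg_lt (ε := δ / (|R| + 1)) (by positivity)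
  refine ⟨max 1 (|A.det| ^ N * M), by positivity, fun x hx => le_max_of_le_right ?_⟩
  have h1 : ‖A ^ (-N) *ᵥ x‖ < δ := by
    refine (Matrix.linfty_opNorm_mulVec _ _).trans_lt ?_
    calc ‖A ^ (-N)‖ * ‖x‖ ≤ δ / (|R| + 1) * |R| := by
          gcongr
          · exact (hN N le_rfl).le
          · exact hx.trans (le_abs_self R)
      _ < δ := by
          rw [div_mul_eq_mul_div, div_lt_iff₀ (by positivity)]
          nlinarith [abs_nonneg R]
  have h2 := hρ.zpow hA.isUnit_det N (A ^ (-N) *ᵥ x)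
  rw [zpow_mulVec_zpow_mulVec hA.isUnit_det, add_neg_cancel, zpow_zero, Matrix.one_mulVec] at h2
  rw [h2]
  gcongr
  exact hM _ h1

/-- Continuity at the origin: near `0` even `A ^ N *ᵥ x` has norm at most `1`, hence `ρ x ≤ |A.det|
^ (-N) * M`. -/
theorem exists_forall_norm_lt_le [NeZero n] (hA : IsDilation A) (hρ : IsHomogeneousQuasiNorm A ρ)
    {ε : ℝ} (hε : 0 < ε) : ∃ δ > 0, ∀ x : Fin n → ℝ, ‖x‖ < δ → ρ x ≤ ε := by
  have hu := hA.isUnit_det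
  have hd := hA.one_lt_abs_det
  obtain ⟨M, hM0, hM⟩ := hρ.exists_forall_norm_le_le hA 1
  obtain ⟨N, hN⟩ := exists_pow_lt_of_lt_one (div_pos hε hM0) (inv_lt_one_of_one_lt₀ hd)
  have hpos : 0 < ‖A ^ (N : ℤ)‖ + 1 := by positivity
  refine ⟨1 / (‖A ^ (N : ℤ)‖ + 1), by positivity, fun x hx => ?_⟩
  have h1 : ‖A ^ (N : ℤ) *ᵥ x‖ ≤ 1 := by
    refine (Matrix.linfty_opNorm_mulVec _ _).trans ?_
    calc ‖A ^ (N : ℤ)‖ * ‖x‖ ≤ (‖A ^ (N : ℤ)‖ + 1) * (1 / (‖A ^ (N : ℤ)‖ + 1)) := by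
          gcongr
          linarith
      _ = 1 := mul_one_div_cancel hpos.ne'
  have h2 := hM _ h1
  rw [hρ.zpow hu, zpow_natCast] at h2
  rw [inv_pow, lt_div_iff₀ hM0, inv_mul_lt_iff₀ (by positivity)] at hN
  exact le_of_mul_le_mul_left (h2.trans hN.le) (by positivity)

/-- Although `ρ` need not be continuous, the quasi-triangle inequality keeps it away from zero near
each nonzero point; compactness of the annulus makes the bound uniform. -/
theorem exists_forall_annulus_ge [NeZero n] (hA : IsDilation A)
    (hρ : IsHomogeneousQuasiNorm A ρ) {r : ℝ} (hr : 0 < r) (R : ℝ) :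
    ∃ m > 0, ∀ x : Fin n → ℝ, r ≤ ‖x‖ → ‖x‖ ≤ R → m ≤ ρ x := by
  obtain ⟨c₀, hc₀⟩ := hρ.quasi_triangle
  obtain ⟨c, hc1, hc⟩ : ∃ c : ℝ, 0 < c ∧ ∀ x y, ρ (x + y) ≤ c * (ρ x + ρ y) :=
    ⟨max 1 c₀, by positivity, fun x y => (hc₀ x y).trans
      (mul_le_mul_of_nonneg_right (le_max_right _ _) (add_nonneg (hρ.nonneg x) (hρ.nonneg y)))⟩
  have hK : IsCompact {x : Fin n → ℝ | r ≤ ‖x‖ ∧ ‖x‖ ≤ R} := by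
    refine (isCompact_closedBall (0 : Fin n → ℝ) R).of_isClosed_subset ?_ fun x hx => by
      simpa using hx.2
    exact (isClosed_le continuous_const continuous_norm).inter
      (isClosed_le continuous_norm continuous_const)
  have := hK.induction_on (p := fun s => ∃ m > 0, ∀ x ∈ s, m ≤ ρ x)
    ⟨1, one_pos, by simp⟩ (fun s t hst ⟨m, hm, h⟩ => ⟨m, hm, fun x hx => h x (hst hx)⟩)
    (fun s t ⟨m, hm, h⟩ ⟨m', hm', h'⟩ => ⟨min m m', lt_min hm hm', fun x hx =>
      hx.elim (fun hx => (min_le_left _ _).trans (h x hx))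
        (fun hx => (min_le_right _ _).trans (h' x hx))⟩)
    (fun x hx => by
      have hx0 : x ≠ 0 := norm_pos_iff.mp (hr.trans_le hx.1)
      have hρx := hρ.pos hx0
      -- The inequality gives `ρ x / c ≤ ρ (x - y) + ρ y`; half of the left side absorbs the
      -- increment and the other half remains for `ρ y`.
      obtain ⟨δ, hδ, h⟩ := hρ.exists_forall_norm_lt_le hA (ε := ρ x / (2 * c)) (by positivity)
      refine ⟨Metric.ball x δ, mem_nhdsWithin_of_mem_nhds (Metric.ball_mem_nhds x hδ),
        ρ x / (2 * c), by positivity, fun y hy => ?_⟩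
      have h1 := h (x - y) (by rwa [← dist_eq_norm, dist_comm])
      have h2 := hc (x - y) y
      rw [sub_add_cancel] at h2
      have h3 : ρ x / c ≤ ρ (x - y) + ρ y := by rwa [div_le_iff₀' hc1]
      have h4 : ρ x / c = ρ x / (2 * c) + ρ x / (2 * c) := by field_simp; ring
      linarith)
  obtain ⟨m, hm, h⟩ := this
  exact ⟨m, hm, fun x h1 h2 => h x ⟨h1, h2⟩⟩

/-- With `x = A ^ k *ᵥ y` and `y` in the annulus, the bound on `ρ x` forces `k < K`. Then `A ^ k = A
^ K * A ^ (-(K - k))`, a fixed matrix times a nonnegative power of the inverse, and such powers are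
bounded. -/
theorem exists_norm_le_of_le [NeZero n] (hA : IsDilation A) (hρ : IsHomogeneousQuasiNorm A ρ)
    (r : ℝ) : ∃ C, ∀ x : Fin n → ℝ, ρ x ≤ r → ‖x‖ ≤ C := by
  have hu := hA.isUnit_det
  have hd := hA.one_lt_abs_det
  obtain ⟨m, hm, hlow⟩ := hρ.exists_forall_annulus_ge hA one_pos ‖A‖
  obtain ⟨K, hK⟩ := pow_unbounded_of_one_lt (r / m) hd
  obtain ⟨C, hC⟩ := hA.tendsto_norm_inv_pow.bddAbove_range
  refine ⟨‖A ^ (K : ℤ)‖ * (C * ‖A‖), fun x hx => ?_⟩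
  have hC0 : 0 ≤ C := (norm_nonneg _).trans (hC ⟨0, rfl⟩)
  rcases eq_or_ne x 0 with rfl | hx0
  · rw [norm_zero]
    positivity
  obtain ⟨k, h1, h2⟩ := hA.exists_norm_zpow_neg_mulVec hx0
  have h3 := hlow _ h1 h2
  rw [hρ.zpow hu] at h3
  have hdk : 0 < |A.det| ^ k := by positivity
  have hkK : k < K := by
    have h4 : m * |A.det| ^ k ≤ r := by
      rw [zpow_neg, ← div_eq_inv_mul, le_div_iff₀ hdk] at h3
      exact h3.trans hx
    have h5 : |A.det| ^ k < |A.det| ^ (K : ℤ) := by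
      rw [zpow_natCast]
      exact lt_of_le_of_lt ((le_div_iff₀' hm).mpr h4) hK
    exact (zpow_lt_zpow_iff_right₀ hd).mp h5
  obtain ⟨j, hj⟩ := Int.eq_ofNat_of_zero_le (sub_nonneg.mpr hkK.le)
  have h6 : x = A ^ (K : ℤ) *ᵥ (A ^ (-(j : ℤ)) *ᵥ (A ^ (-k) *ᵥ x)) := by
    rw [zpow_mulVec_zpow_mulVec hu, zpow_mulVec_zpow_mulVec hu, ← hj,
      show (K : ℤ) + -(K - k) + -k = 0 by ring, zpow_zero, Matrix.one_mulVec]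
  rw [h6]
  refine (Matrix.linfty_opNorm_mulVec _ _).trans ?_
  gcongr
  refine (Matrix.linfty_opNorm_mulVec _ _).trans ?_
  gcongr
  exact hC ⟨j, rfl⟩

/-- Normalising `x` by `A ^ (-k)` and `S *ᵥ x` by `B ^ (-m k)` puts both into fixed annuli, the
second one by the two boundedness hypotheses. There `ρ` and `σ` are comparable to constants, and the
scaling factors are comparable by assumption. -/
theorem quasiNormEquivUpToLinear_of_bounded [NeZero n] (hA : IsDilation A) (hB : IsDilation B)
    {σ : (Fin n → ℝ) → ℝ} (hρ : IsHomogeneousQuasiNorm A ρ) (hσ : IsHomogeneousQuasiNorm B σ)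
    (S : GL (Fin n) ℝ) (m : ℤ → ℤ) {C : ℝ}
    (h₁ : ∀ k, |A.det| ^ k ≤ C * |B.det| ^ m k) (h₂ : ∀ k, |B.det| ^ m k ≤ C * |A.det| ^ k)
    (h₃ : ∀ k, ‖B ^ (-m k) * S.1 * A ^ k‖ ≤ C)
    (h₄ : ∀ k, ‖A ^ (-k) * S⁻¹.1 * B ^ m k‖ ≤ C) : QuasiNormEquivUpToLinear ρ σ := by
  have huA := hA.isUnit_det
  have huB := hB.isUnit_det
  have hdA : 0 < |A.det| := one_pos.trans hA.one_lt_abs_det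
  have hdB : 0 < |B.det| := one_pos.trans hB.one_lt_abs_det
  have hC : 0 < C := by
    have := h₁ 0
    have h5 : 0 < |B.det| ^ m 0 := by positivity
    rw [zpow_zero] at this
    by_contra! h
    nlinarith
  obtain ⟨a, ha, hal⟩ := hρ.exists_forall_annulus_ge hA one_pos ‖A‖
  obtain ⟨a', ha', hau⟩ := hρ.exists_forall_norm_le_le hA ‖A‖
  obtain ⟨b, hb, hbl⟩ := hσ.exists_forall_annulus_ge hB (inv_pos.mpr hC) (C * ‖A‖)
  obtain ⟨b', hb', hbu⟩ := hσ.exists_forall_norm_le_le hB (C * ‖A‖)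
  have key : ∀ x, ρ x ≤ a' * C / b * σ (S.1 *ᵥ x) ∧ σ (S.1 *ᵥ x) ≤ b' * C / a * ρ x := by
    intro x
    rcases eq_or_ne x 0 with rfl | hx0
    · simp [(hρ.eq_zero_iff 0).mpr rfl, (hσ.eq_zero_iff 0).mpr rfl]
    obtain ⟨k, hk1, hk2⟩ := hA.exists_norm_zpow_neg_mulVec hx0
    set y := A ^ (-k) *ᵥ x with hy
    have hxy : x = A ^ k *ᵥ y := by
      rw [hy, zpow_mulVec_zpow_mulVec huA, add_neg_cancel, zpow_zero, Matrix.one_mulVec]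
    set z := (B ^ (-m k) * S.1 * A ^ k) *ᵥ y with hz
    clear_value y
    have hSz : S.1 *ᵥ x = B ^ m k *ᵥ z := by
      rw [hz, hxy, Matrix.mulVec_mulVec, Matrix.mulVec_mulVec, mul_assoc, ← mul_assoc (B ^ m k),
        ← Matrix.zpow_add huB, add_neg_cancel, zpow_zero, one_mul]
    have hyz : y = (A ^ (-k) * S⁻¹.1 * B ^ m k) *ᵥ z := by
      rw [← Matrix.mulVec_mulVec, ← hSz, Matrix.mulVec_mulVec, mul_assoc, ← Units.val_mul,
        inv_mul_cancel, Units.val_one, mul_one, hy]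
    have hz1 : ‖z‖ ≤ C * ‖A‖ := (Matrix.linfty_opNorm_mulVec _ _).trans (by gcongr; exact h₃ k)
    have hz2 : C⁻¹ ≤ ‖z‖ := by
      have h6 : ‖y‖ ≤ C * ‖z‖ := by
        rw [hyz]
        exact (Matrix.linfty_opNorm_mulVec _ _).trans (by gcongr; exact h₄ k)
      rw [inv_le_iff_one_le_mul₀' hC]
      exact hk1.trans h6
    rw [hSz, hσ.zpow huB, hxy, hρ.zpow huA]
    have e1 := hal y hk1 hk2
    have e2 := hau y hk2
    have e3 := hbl z hz2 hz1
    have e4 := hbu z hz1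
    constructor
    · calc |A.det| ^ k * ρ y ≤ (C * |B.det| ^ m k) * a' :=
            mul_le_mul (h₁ k) e2 (hρ.nonneg _) (by positivity)
        _ = a' * C / b * (|B.det| ^ m k * b) := by field_simp
        _ ≤ _ := by gcongr
    · calc |B.det| ^ m k * σ z ≤ (C * |A.det| ^ k) * b' :=
            mul_le_mul (h₂ k) e4 (hσ.nonneg _) (by positivity)
        _ = b' * C / a * (|A.det| ^ k * a) := by field_simp
        _ ≤ _ := by gcongr
  refine ⟨max (a' * C / b) (b' * C / a), by positivity, S, fun x => ⟨?_, ?_⟩⟩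
  · rw [one_div, inv_mul_le_iff₀ (by positivity)]
    exact (key x).1.trans (mul_le_mul_of_nonneg_right (le_max_left _ _) (hσ.nonneg _))
  · exact (key x).2.trans (mul_le_mul_of_nonneg_right (le_max_right _ _) (hρ.nonneg _))

end IsHomogeneousQuasiNorm

/-! ### Existence of a quasi-norm -/

/-- The step quasi-norm of a dilation `A`: the largest `|det A| ^ k` with `1 ≤ ‖A⁻ᵏ x‖`. -/
noncomputable def stepQuasiNorm (A : Matrix (Fin n) (Fin n) ℝ) (x : Fin n → ℝ) : ℝ :=
  ⨆ k : ℤ, {y : Fin n → ℝ | 1 ≤ ‖A ^ (-k) *ᵥ y‖}.indicator (fun _ => |A.det| ^ k) x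

theorem stepQuasiNorm_nonneg (A : Matrix (Fin n) (Fin n) ℝ) (x : Fin n → ℝ) :
    0 ≤ stepQuasiNorm A x :=
  Real.iSup_nonneg fun k => indicator_nonneg (fun _ _ => by positivity) _

/-- Since a real supremum of an unbounded family is `0` by convention, boundedness is what makes the
step quasi-norm dominate its terms: for large `k` the vector `A ^ (-k) *ᵥ x` is short and the
indicator vanishes. -/
theorem IsDilation.bddAbove_stepQuasiNorm [NeZero n] (hA : IsDilation A) (x : Fin n → ℝ) :
    BddAbove (range fun k : ℤ =>
      {y : Fin n → ℝ | 1 ≤ ‖A ^ (-k) *ᵥ y‖}.indicator (fun _ => |A.det| ^ k) x) := by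
  obtain ⟨N, hN⟩ := hA.exists_forall_norm_zpow_neg_lt (ε := (‖x‖ + 1)⁻¹) (by positivity)
  refine ⟨|A.det| ^ N, ?_⟩
  rintro _ ⟨k, rfl⟩
  refine indicator_apply_le' (fun h => ?_) (fun _ => by positivity)
  refine zpow_le_zpow_right₀ hA.one_lt_abs_det.le ?_
  by_contra! hk
  have h1 : ‖A ^ (-k) *ᵥ x‖ ≤ (‖x‖ + 1)⁻¹ * ‖x‖ :=
    (Matrix.linfty_opNorm_mulVec _ _).trans (by gcongr; exact (hN k hk.le).le)
  have h2 : (‖x‖ + 1)⁻¹ * ‖x‖ < 1 := by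
    rw [inv_mul_lt_iff₀ (by positivity)]
    linarith
  have h3 : 1 ≤ ‖A ^ (-k) *ᵥ x‖ := h
  linarith

theorem IsDilation.zpow_le_stepQuasiNorm [NeZero n] (hA : IsDilation A) {x : Fin n → ℝ} {k : ℤ}
    (hk : 1 ≤ ‖A ^ (-k) *ᵥ x‖) : |A.det| ^ k ≤ stepQuasiNorm A x := by
  have := le_ciSup (hA.bddAbove_stepQuasiNorm x) k
  rwa [indicator_of_mem (by exact hk)] at this

theorem IsDilation.isHomogeneousQuasiNorm_stepQuasiNorm [NeZero n] (hA : IsDilation A) :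
    IsHomogeneousQuasiNorm A (stepQuasiNorm A) where
  measurable := by
    refine (Measurable.iSup fun k => ?_).nullMeasurable
    refine measurable_const.indicator (IsClosed.measurableSet ?_)
    exact isClosed_le continuous_const (by fun_prop)
  nonneg := stepQuasiNorm_nonneg A
  eq_zero_iff x := by
    refine ⟨fun h => ?_, ?_⟩
    · by_contra hx
      obtain ⟨k, hk, -⟩ := hA.exists_norm_zpow_neg_mulVec hx
      have h1 := hA.zpow_le_stepQuasiNorm hk
      have h2 : 0 < |A.det| := one_pos.trans hA.one_lt_abs_det
      have h3 : 0 < |A.det| ^ k := by positivity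
      linarith
    · rintro rfl
      have : ¬ (1 : ℝ) ≤ 0 := by norm_num
      simp [stepQuasiNorm, this]
  homogeneous x := by
    have h2 : |A.det| ≠ 0 := (one_pos.trans hA.one_lt_abs_det).ne'
    unfold stepQuasiNorm
    rw [Real.mul_iSup_of_nonneg (abs_nonneg _), ← (Equiv.addRight (1 : ℤ)).iSup_comp]
    refine iSup_congr fun k => ?_
    have h1 : A ^ (-(k + 1)) *ᵥ (A *ᵥ x) = A ^ (-k) *ᵥ x := by
      nth_rw 2 [← zpow_one A]
      rw [zpow_mulVec_zpow_mulVec hA.isUnit_det, show -(k + 1) + 1 = -k by ring]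
    simp only [Equiv.coe_addRight, indicator, mem_ofPred_eq, h1, zpow_add_one₀ h2]
    split_ifs <;> ring
  quasi_triangle := by
    have hu := hA.isUnit_det
    have hd := hA.one_lt_abs_det
    -- If `1 ≤ ‖A ^ (-k) *ᵥ (x + y)‖`, one of the two summands has norm at least `1 / 2`. As `A ^
    -- (-N)` has norm below `1 / 2`, undoing it brings that norm up to at least `1`, at the price
    -- `|A.det| ^ N`.
    obtain ⟨N, hN⟩ := hA.exists_forall_norm_zpow_neg_lt (ε := 1 / 2) (by positivity)
    refine ⟨|A.det| ^ N, fun x y => ?_⟩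
    have hx := stepQuasiNorm_nonneg A x
    have hy := stepQuasiNorm_nonneg A y
    have half : ∀ (k : ℤ) (v : Fin n → ℝ), 1 / 2 ≤ ‖A ^ (-k) *ᵥ v‖ →
        |A.det| ^ k ≤ |A.det| ^ N * stepQuasiNorm A v := by
      intro k v hv
      have h1 : A ^ (-k) *ᵥ v = A ^ (-N) *ᵥ (A ^ (-(k - N)) *ᵥ v) := by
        rw [zpow_mulVec_zpow_mulVec hu, show -N + -(k - N) = -k by ring]
      have h2 := Matrix.linfty_opNorm_mulVec (A ^ (-N)) (A ^ (-(k - N)) *ᵥ v)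
      have h3 : ‖A ^ (-N)‖ * ‖A ^ (-(k - N)) *ᵥ v‖ ≤ 1 / 2 * ‖A ^ (-(k - N)) *ᵥ v‖ := by
        gcongr
        exact (hN N le_rfl).le
      rw [← h1] at h2
      have h4 := hA.zpow_le_stepQuasiNorm (x := v) (k := k - N) (by linarith)
      have h0 : 0 < |A.det| := by linarith
      calc |A.det| ^ k = |A.det| ^ N * |A.det| ^ (k - N) := by
            rw [← zpow_add₀ h0.ne', add_sub_cancel]
        _ ≤ _ := by gcongr
    refine ciSup_le fun k => indicator_apply_le' (fun hk => ?_) (fun _ => by positivity)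
    have hk' : 1 ≤ ‖A ^ (-k) *ᵥ x + A ^ (-k) *ᵥ y‖ := by
      rw [← Matrix.mulVec_add]
      exact hk
    have h1 := norm_add_le (A ^ (-k) *ᵥ x) (A ^ (-k) *ᵥ y)
    have hdN : 0 ≤ |A.det| ^ N := by positivity
    rcases le_total (1 / 2) ‖A ^ (-k) *ᵥ x‖ with h | h
    · exact (half k x h).trans (by gcongr; linarith)
    · exact (half k y (by linarith)).trans (by gcongr; linarith)

theorem QuasiNormEquivUpToLinear.symm {ρ σ : (Fin n → ℝ) → ℝ}
    (h : QuasiNormEquivUpToLinear ρ σ) : QuasiNormEquivUpToLinear σ ρ := by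
  obtain ⟨c, hc, S, h⟩ := h
  refine ⟨c, hc, S⁻¹, fun x => ?_⟩
  have h1 := h (S⁻¹.1 *ᵥ x)
  rw [Matrix.mulVec_mulVec, ← Units.val_mul, mul_inv_cancel, Units.val_one, Matrix.one_mulVec] at h1
  rw [one_div, inv_mul_le_iff₀ hc] at h1 ⊢
  exact h1.symm

theorem QuasiNormEquivUpToLinear.trans {ρ σ τ : (Fin n → ℝ) → ℝ}
    (h₁ : QuasiNormEquivUpToLinear ρ σ) (h₂ : QuasiNormEquivUpToLinear σ τ) :
    QuasiNormEquivUpToLinear ρ τ := by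
  obtain ⟨c, hc, S, h₁⟩ := h₁
  obtain ⟨d, hd, T, h₂⟩ := h₂
  refine ⟨c * d, by positivity, T * S, fun x => ?_⟩
  have a := h₁ x
  have b := h₂ (S.1 *ᵥ x)
  rw [Units.val_mul, ← Matrix.mulVec_mulVec]
  rw [one_div, inv_mul_le_iff₀ (by positivity)] at a b ⊢
  refine ⟨a.1.trans ?_, b.2.trans ?_⟩
  · rw [mul_assoc]
    gcongr
    exact b.1
  · rw [mul_comm c d, mul_assoc]
    gcongr
    exact a.2

/-! ### Rigidity of bounded orbits -/

section Rigidity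

variable {Y : Matrix (Fin n) (Fin n) ℝ}

theorem Matrix.mul_zpow_of_mul_eq_smul (hA : IsUnit A.det) {a : ℝ} (ha : a ≠ 0)
    (h : Y * A = a • Y) (k : ℤ) : Y * A ^ k = a ^ k • Y := by
  induction k with
  | zero => simp
  | succ k ih =>
    rw [Matrix.zpow_add_one hA, ← mul_assoc, ih, Matrix.smul_mul, h, smul_smul, zpow_add_one₀ ha]
  | pred k ih =>
    have h' : Y * A⁻¹ = a⁻¹ • Y := by
      rw [eq_inv_smul_iff₀ ha, ← Matrix.smul_mul, ← h, mul_assoc, Matrix.mul_nonsing_inv A hA,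
        mul_one]
    rw [Matrix.zpow_sub_one hA, ← mul_assoc, ih, Matrix.smul_mul, h', smul_smul, zpow_sub_one₀ ha]

theorem Matrix.zpow_mul_of_mul_eq_smul (hB : IsUnit B.det) {b : ℝ} (hb : b ≠ 0)
    (h : B * Y = b • Y) (k : ℤ) : B ^ k * Y = b ^ k • Y := by
  have h1 : Yᵀ * Bᵀ = b • Yᵀ := by
    rw [← Matrix.transpose_mul, h, Matrix.transpose_smul]
  have h2 := Matrix.mul_zpow_of_mul_eq_smul (by rwa [Matrix.det_transpose]) hb h1 k
  rw [← Matrix.transpose_zpow, ← Matrix.transpose_mul] at h2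
  exact Matrix.transpose_injective (h2.trans (Matrix.transpose_smul _ _).symm)

theorem eq_one_of_forall_zpow_le {r C : ℝ} (hr : 0 < r) (h : ∀ k : ℤ, r ^ k ≤ C) : r = 1 := by
  have aux : ∀ s : ℝ, (∀ k : ℕ, s ^ k ≤ C) → s ≤ 1 := fun s hs => by
    by_contra! h1
    obtain ⟨k, hk⟩ := pow_unbounded_of_one_lt C h1
    exact absurd (hs k) (not_le.mpr hk)
  refine le_antisymm (aux r fun k => by exact_mod_cast h k) ?_
  have h2 := aux r⁻¹ fun k => by
    have := h (-k)
    rwa [zpow_neg, zpow_natCast, ← inv_pow] at this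
  exact (inv_le_one₀ hr).mp h2

/-- If `Y A = a Y`, `B Y = b Y` for `Y = X A - B X` and the orbit of `X` under
`X ↦ B⁻¹ X A` is bounded, then `Y = 0`. -/
theorem sub_eq_zero_of_bounded_of_eigen (hA : IsUnit A.det) (hB : IsUnit B.det)
    {X : Matrix (Fin n) (Fin n) ℝ} {a b : ℝ} (ha : 0 < a) (hb : 0 < b)
    (h₁ : (X * A - B * X) * A = a • (X * A - B * X))
    (h₂ : B * (X * A - B * X) = b • (X * A - B * X))
    {C : ℝ} (hC : ∀ k : ℤ, ‖B ^ (-k) * X * A ^ k‖ ≤ C) : X * A - B * X = 0 := by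
  set Y := X * A - B * X with hY
  by_contra hY0
  have hYpos : 0 < ‖Y‖ := norm_pos_iff.mpr hY0
  have hYk : ∀ k : ℤ, B ^ (-k) * Y * A ^ k = (a / b) ^ k • Y := fun k => by
    rw [Matrix.zpow_mul_of_mul_eq_smul hB hb.ne' h₂, Matrix.smul_mul,
      Matrix.mul_zpow_of_mul_eq_smul hA ha.ne' h₁, smul_smul, div_zpow, zpow_neg, mul_comm,
      div_eq_mul_inv]
  have hYC : ∀ k : ℤ, ‖B ^ (-k) * Y * A ^ k‖ ≤ C * ‖A‖ + ‖B‖ * C := fun k => by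
    have e : B ^ (-k) * Y * A ^ k
        = (B ^ (-k) * X * A ^ k) * A - B * (B ^ (-k) * X * A ^ k) := by
      have e1 := (Matrix.Commute.self_zpow A k).eq
      have e2 := (Matrix.Commute.self_zpow B (-k)).eq
      rw [hY, mul_sub, sub_mul]
      congr 1
      · simp only [mul_assoc, e1]
      · simp only [← mul_assoc, e2]
    rw [e]
    refine (norm_sub_le _ _).trans (add_le_add ((norm_mul_le _ _).trans ?_)
      ((norm_mul_le _ _).trans ?_)) <;> gcongr <;> exact hC k
  -- The conjugates of `Y` are the multiples `(a / b) ^ k • Y`, and they are bounded for positive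
  -- and negative `k`. Positivity of `a / b` matters here, since it excludes phases.
  have hab : a / b = 1 := eq_one_of_forall_zpow_le (div_pos ha hb)
    (C := (C * ‖A‖ + ‖B‖ * C) / ‖Y‖) fun k => by
      have := hYC k
      rw [hYk, norm_smul, Real.norm_of_nonneg (by positivity)] at this
      rwa [le_div_iff₀ hYpos]
  -- With `a = b`, the orbit of `X` moves by the constant `b⁻¹ • Y` at each step. Such linear growth
  -- is bounded only if `Y = 0`.
  have hM : ∀ k : ℕ, B ^ (-(k : ℤ)) * X * A ^ (k : ℤ) = X + (k * b⁻¹ : ℝ) • Y := by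
    intro k
    induction k with
    | zero => simp
    | succ k ih =>
      have e1 : B ^ (-((k + 1 : ℕ) : ℤ)) * B = B ^ (-(k : ℤ)) := by
        rw [← Matrix.zpow_add_one hB]
        congr 1
        push_cast
        ring
      have e2 : A * A ^ (k : ℤ) = A ^ ((k + 1 : ℕ) : ℤ) := by
        rw [← Matrix.zpow_one_add hA]
        congr 1
        push_cast
        ring
      have e3 : B ^ (-((k + 1 : ℕ) : ℤ)) = B⁻¹ * B ^ (-(k : ℤ)) := by
        rw [← Matrix.zpow_neg_one, ← Matrix.zpow_add hB]
        congr 1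
        push_cast
        ring
      have e4 : B⁻¹ * Y = b⁻¹ • Y := by
        have := Matrix.zpow_mul_of_mul_eq_smul hB hb.ne' h₂ (-1)
        simpa using this
      have e5 := hYk k
      rw [hab, one_zpow, one_smul] at e5
      have e6 : B ^ (-((k + 1 : ℕ) : ℤ)) * Y * A ^ (k : ℤ) = b⁻¹ • Y := by
        rw [e3, mul_assoc, mul_assoc, ← mul_assoc (B ^ _), e5, e4]
      rw [hY, mul_sub, sub_mul, ← mul_assoc, ← mul_assoc, e1, ih, mul_assoc, e2, ← hY,
        sub_eq_iff_eq_add] at e6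
      rw [e6]
      push_cast
      module
  obtain ⟨k, hk⟩ := exists_nat_gt ((C + ‖X‖) * b / ‖Y‖)
  have h3 := hC k
  rw [hM] at h3
  have h4 := norm_sub_le (X + (k * b⁻¹ : ℝ) • Y) X
  rw [add_sub_cancel_left, norm_smul, Real.norm_of_nonneg (by positivity)] at h4
  rw [div_lt_iff₀ hYpos] at hk
  have h5 : k * b⁻¹ * ‖Y‖ * b = k * ‖Y‖ := by field_simp
  nlinarith

open Polynomial in
/-- Rigidity of bounded two-sided orbits of `X ↦ B⁻¹ X A` for matrices with positive spectrum. -/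
theorem mul_eq_mul_of_bounded (hA : IsUnit A.det) (hB : IsUnit B.det) (s t : Multiset ℝ)
    (hs : ∀ a ∈ s, 0 < a) (ht : ∀ b ∈ t, 0 < b) (X : Matrix (Fin n) (Fin n) ℝ)
    (hXA : X * aeval A (s.map fun a => Polynomial.X - Polynomial.C a).prod = 0)
    (hBX : aeval B (t.map fun b => Polynomial.X - Polynomial.C b).prod * X = 0)
    {C : ℝ} (hC : ∀ k : ℤ, ‖B ^ (-k) * X * A ^ k‖ ≤ C) : X * A = B * X := by
  induction s using Multiset.induction_on generalizing t X C with
  | empty =>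
    have : X = 0 := by simpa using hXA
    simp [this]
  | cons a s ihs =>
    induction t using Multiset.induction_on generalizing X C with
    | empty =>
      have : X = 0 := by simpa using hBX
      simp [this]
    | cons b t iht =>
      have ha := hs a (Multiset.mem_cons_self a s)
      have hb := ht b (Multiset.mem_cons_self b t)
      -- Removing a linear factor on either side leaves the orbit bounded, so by induction `X * (A -
      -- a)` and `(B - b) * X` already intertwine `A` and `B`. Hence `Y = X * A - B * X` satisfies
      -- `Y * A = a • Y` and `B * Y = b • Y`.
      have h1 : X * (A - a • 1) * A = B * (X * (A - a • 1)) := by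
        refine ihs (b ::ₘ t) (fun x hx => hs x (Multiset.mem_cons_of_mem hx)) ht _ ?_ ?_
          (C := C * ‖A - a • 1‖) ?_
        · rw [Multiset.map_cons, Multiset.prod_cons, map_mul, map_sub, aeval_X, aeval_C,
            Algebra.algebraMap_eq_smul_one, ← mul_assoc] at hXA
          exact hXA
        · rw [← mul_assoc, hBX, zero_mul]
        · intro k
          have e : Commute (A - a • 1) (A ^ k) :=
            ((Matrix.Commute.self_zpow A k).sub_left ((Commute.one_left _).smul_left a))
          have e' : B ^ (-k) * (X * (A - a • 1)) * A ^ k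
              = (B ^ (-k) * X * A ^ k) * (A - a • 1) := by
            simp only [mul_assoc, e.eq]
          rw [e']
          exact (norm_mul_le _ _).trans (by gcongr; exact hC k)
      have h2 : (B - b • 1) * X * A = B * ((B - b • 1) * X) := by
        refine iht (fun x hx => ht x (Multiset.mem_cons_of_mem hx)) _ ?_ ?_
          (C := ‖B - b • 1‖ * C) ?_
        · rw [mul_assoc, hXA, mul_zero]
        · rw [Multiset.map_cons, Multiset.prod_cons, mul_comm, map_mul, map_sub, aeval_X, aeval_C,
            Algebra.algebraMap_eq_smul_one, mul_assoc] at hBX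
          exact hBX
        · intro k
          have e : Commute (B ^ (-k)) (B - b • 1) :=
            (((Matrix.Commute.self_zpow B (-k)).sub_left ((Commute.one_left _).smul_left b))).symm
          have e' : B ^ (-k) * ((B - b • 1) * X) * A ^ k
              = (B - b • 1) * (B ^ (-k) * X * A ^ k) := by
            simp only [← mul_assoc, e.eq]
          rw [e']
          exact (norm_mul_le _ _).trans (by gcongr; exact hC k)
      refine sub_eq_zero.mp (sub_eq_zero_of_bounded_of_eigen hA hB ha hb ?_ ?_ hC)
      · rw [← sub_eq_zero] at h1 ⊢
        rw [← h1]
        simp only [mul_sub, sub_mul, Matrix.mul_smul, Matrix.smul_mul, mul_one, mul_assoc, smul_sub]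
        abel
      · rw [← sub_eq_zero] at h2 ⊢
        rw [← h2]
        simp only [mul_sub, sub_mul, Matrix.mul_smul, Matrix.smul_mul, one_mul, mul_assoc, smul_sub]
        abel

end Rigidity

/-- Equivalent quasi-norms of dilations with the same determinant give a bounded orbit. -/
theorem QuasiNormEquivUpToLinear.exists_bounded [NeZero n] {ρ σ : (Fin n → ℝ) → ℝ}
    (hA : IsDilation A) (hB : IsDilation B) (hdet : |A.det| = |B.det|)
    (hρ : IsHomogeneousQuasiNorm A ρ) (hσ : IsHomogeneousQuasiNorm B σ)
    (h : QuasiNormEquivUpToLinear ρ σ) :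
    ∃ S : GL (Fin n) ℝ, ∃ C, ∀ k : ℤ, ‖B ^ (-k) * S.1 * A ^ k‖ ≤ C := by
  obtain ⟨c, hc, S, h⟩ := h
  obtain ⟨M, hM0, hM⟩ := hρ.exists_forall_norm_le_le hA 1
  obtain ⟨C, hC⟩ := hσ.exists_norm_le_of_le hB (c * M)
  have hd : 0 < |B.det| := one_pos.trans hB.one_lt_abs_det
  -- The equal determinants cancel: `σ` of the image is at most `c * ρ x`, uniformly in `k`, and
  -- sublevel sets of `σ` are bounded in norm.
  have key : ∀ (k : ℤ) (x : Fin n → ℝ), ‖x‖ ≤ 1 → ‖(B ^ (-k) * S.1 * A ^ k) *ᵥ x‖ ≤ C := by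
    intro k x hx
    refine hC _ ?_
    rw [mul_assoc, ← Matrix.mulVec_mulVec, hσ.zpow hB.isUnit_det, ← Matrix.mulVec_mulVec]
    have h1 := (h (A ^ k *ᵥ x)).2
    rw [hρ.zpow hA.isUnit_det, hdet] at h1
    have hdk : 0 < |B.det| ^ k := by positivity
    rw [zpow_neg, inv_mul_le_iff₀ hdk]
    calc _ ≤ _ := h1
      _ = |B.det| ^ k * (c * ρ x) := by ring
      _ ≤ _ := by
        gcongr
        exact hM x hx
  refine ⟨S, n * C, fun k => ?_⟩
  set T := B ^ (-k) * S.1 * A ^ k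
  have hent : ∀ i j, ‖T i j‖ ≤ C := fun i j => by
    have h1 := key k (Pi.single j 1) (by simp [Pi.norm_single])
    rw [Matrix.mulVec_single_one] at h1
    exact (norm_le_pi_norm (T.col j) i).trans h1
  rw [Matrix.linfty_opNorm_def]
  have hC0 : 0 ≤ C := (norm_nonneg _).trans (key 0 0 (by simp))
  have : (Finset.univ.sup fun i => ∑ j, ‖T i j‖₊) ≤ Real.toNNReal (n * C) := by
    refine Finset.sup_le fun i _ => ?_
    rw [← NNReal.coe_le_coe, Real.coe_toNNReal _ (by positivity)]
    push_cast
    calc ∑ j, ‖T i j‖ ≤ ∑ _j : Fin n, C := Finset.sum_le_sum fun j _ => hent i j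
      _ = n * C := by simp
  rw [← NNReal.coe_le_coe, Real.coe_toNNReal _ (by positivity)] at this
  exact this

/-! ### Invariants of Jordan matrices -/

section JordanMatrix

variable {ι : Type*} [DecidableEq ι]

/-- The block diagonal matrix of the Jordan blocks with eigenvalue `(f x).1` and size `(f x).2`. -/
def jordanMatrix (f : ι → ℝ × ℕ) :
    Matrix (Σ x, Fin (f x).2) (Σ x, Fin (f x).2) ℝ :=
  Matrix.blockDiagonal' fun x => jordanBlock (f x).1 (f x).2

theorem jordanMatrix_apply_self (f : ι → ℝ × ℕ) (i : Σ x, Fin (f x).2) :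
    jordanMatrix f i i = (f i.1).1 := by
  obtain ⟨x, i⟩ := i
  rw [jordanMatrix, Matrix.blockDiagonal'_apply_eq]
  simp [jordanBlock]

variable [Fintype ι]

/-- Blocks are enumerated arbitrarily and positions ordered lexicographically, so the triangular
formulas for the determinant and the characteristic polynomial apply. -/
theorem exists_linearOrder_isUpperTriangular_jordanMatrix (f : ι → ℝ × ℕ) :
    ∃ o : LinearOrder (Σ x, Fin (f x).2), ∀ i j, o.lt j i → jordanMatrix f i j = 0 := by
  let e := Fintype.equivFin ι
  let φ : (Σ x, Fin (f x).2) → Lex (ℕ × ℕ) := fun i => toLex ((e i.1 : ℕ), (i.2 : ℕ))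
  have hφ : Function.Injective φ := by
    rintro ⟨x, i⟩ ⟨y, j⟩ h
    obtain ⟨h1, h2⟩ := Prod.mk.inj (toLex.injective h)
    obtain rfl : x = y := e.injective (Fin.ext h1)
    obtain rfl : i = j := Fin.ext h2
    rfl
  refine ⟨LinearOrder.lift' φ hφ, ?_⟩
  rintro ⟨x, i⟩ ⟨y, j⟩ h
  have h' : φ ⟨y, j⟩ < φ ⟨x, i⟩ := h
  rw [Prod.Lex.toLex_lt_toLex] at h'
  by_cases hxy : x = y
  · subst hxy
    have hji : (j : ℕ) < i := by simpa using h'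
    rw [jordanMatrix, Matrix.blockDiagonal'_apply_eq]
    simp only [jordanBlock, Matrix.of_apply]
    rw [if_neg (by rintro rfl; omega), if_neg (by omega)]
  · rw [jordanMatrix, Matrix.blockDiagonal'_apply_ne _ _ _ hxy]

open Polynomial in
theorem charpoly_jordanMatrix (f : ι → ℝ × ℕ) :
    (jordanMatrix f).charpoly = ∏ x, (X - C (f x).1) ^ (f x).2 := by
  obtain ⟨o, h⟩ := exists_linearOrder_isUpperTriangular_jordanMatrix f
  have := Matrix.charpoly_of_isUpperTriangular (jordanMatrix f) fun i j => h i j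
  rw [Fintype.prod_sigma] at this
  simp only [jordanMatrix_apply_self, Finset.prod_const, Finset.card_univ, Fintype.card_fin] at this
  convert this

theorem det_jordanMatrix (f : ι → ℝ × ℕ) :
    (jordanMatrix f).det = ∏ x, (f x).1 ^ (f x).2 := by
  obtain ⟨o, h⟩ := exists_linearOrder_isUpperTriangular_jordanMatrix f
  have := Matrix.det_of_isUpperTriangular (M := jordanMatrix f) fun i j => h i j
  rw [Fintype.prod_sigma] at this
  simp only [jordanMatrix_apply_self, Finset.prod_const, Finset.card_univ, Fintype.card_fin] at this
  convert this

theorem finrank_ker_blockDiagonal' {K : Type*} [Field K] {m : ι → ℕ}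
    (M : ∀ x, Matrix (Fin (m x)) (Fin (m x)) K) :
    Module.finrank K (Matrix.blockDiagonal' M).mulVecLin.ker
      = ∑ x, Module.finrank K (M x).mulVecLin.ker := by
  have key : ∀ (v : (Σ x, Fin (m x)) → K) (x : ι) (i : Fin (m x)),
      (Matrix.blockDiagonal' M *ᵥ v) ⟨x, i⟩ = (M x *ᵥ fun j => v ⟨x, j⟩) i := by
    intro v x i
    simp only [Matrix.mulVec, dotProduct]
    rw [Fintype.sum_sigma, Finset.sum_eq_single x]
    · simp
    · intro y _ hy
      refine Finset.sum_eq_zero fun j _ => ?_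
      rw [Matrix.blockDiagonal'_apply_ne _ _ _ hy.symm, zero_mul]
    · simp
  rw [← Module.finrank_pi_fintype]
  refine LinearEquiv.finrank_eq
    { toFun := fun v x => ⟨fun j => v.1 ⟨x, j⟩, ?_⟩
      map_add' := fun _ _ => rfl
      map_smul' := fun _ _ => rfl
      invFun := fun w => ⟨fun i => (w i.1).1 i.2, ?_⟩
      left_inv := fun _ => rfl
      right_inv := fun _ => rfl }
  · have := v.2
    rw [LinearMap.mem_ker, Matrix.mulVecLin_apply] at this ⊢
    ext i
    rw [← key, this]
    rfl
  · rw [LinearMap.mem_ker, Matrix.mulVecLin_apply]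
    ext ⟨x, i⟩
    rw [key]
    have := (w x).2
    rw [LinearMap.mem_ker, Matrix.mulVecLin_apply] at this
    exact congrFun this i

theorem jordanBlock_sub_pow_mulVec (a : ℝ) (m j : ℕ) (v : Fin m → ℝ) (i : Fin m) :
    ((jordanBlock a m - a • 1) ^ j *ᵥ v) i = if h : (i : ℕ) + j < m then v ⟨i + j, h⟩ else 0 := by
  induction j generalizing i with
  | zero => simp
  | succ j ih =>
    have h1 : ∀ (w : Fin m → ℝ) (i : Fin m), ((jordanBlock a m - a • 1) *ᵥ w) i
        = if h : (i : ℕ) + 1 < m then w ⟨i + 1, h⟩ else 0 := by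
      intro w i
      simp only [Matrix.mulVec, dotProduct]
      have h2 : ∀ k : Fin m, (jordanBlock a m - a • 1) i k * w k
          = if (i : ℕ) + 1 = k then w k else 0 := by
        intro k
        simp only [jordanBlock, Matrix.sub_apply, Matrix.of_apply, Matrix.smul_apply,
          Matrix.one_apply]
        by_cases hik : i = k
        · subst hik
          simp
        · simp [hik]
      simp only [h2]
      split_ifs with h
      · rw [Finset.sum_eq_single ⟨i + 1, h⟩]
        · simp
        · intro k _ hk
          rw [if_neg]
          rintro h3
          exact hk (Fin.ext h3.symm)
        · simp
      · refine Finset.sum_eq_zero fun k _ => if_neg ?_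
        have := k.2
        omega
    rw [pow_succ', ← Matrix.mulVec_mulVec, h1]
    split_ifs with h h' h'
    · rw [ih, dif_pos (by simp only; omega)]
      congr 2
      simp only
      omega
    · rw [ih, dif_neg (by simp only; omega)]
    · omega
    · rfl

/-- The power shifts coordinates by `j`, so the kernel consists of the vectors supported on the
first `j` coordinates. -/
theorem finrank_ker_jordanBlock_sub_pow (a : ℝ) (m j : ℕ) :
    Module.finrank ℝ ((jordanBlock a m - a • 1) ^ j).mulVecLin.ker = min j m := by
  have h : ((jordanBlock a m - a • 1) ^ j).mulVecLin.ker
      = ⨅ i ∈ {i : Fin m | j ≤ i}, (LinearMap.proj i : (Fin m → ℝ) →ₗ[ℝ] ℝ).ker := by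
    ext v
    simp only [LinearMap.mem_ker, Matrix.mulVecLin_apply, Submodule.mem_iInf, mem_ofPred_eq,
      LinearMap.proj_apply]
    constructor
    · intro hv i hi
      have := congrFun hv ⟨i - j, by omega⟩
      rw [jordanBlock_sub_pow_mulVec, dif_pos (by simp only; omega)] at this
      rw [Pi.zero_apply] at this
      rw [← this]
      congr 1
      ext
      simp only
      omega
    · intro hv
      ext i
      rw [jordanBlock_sub_pow_mulVec]
      split_ifs with h
      · exact hv _ (by simp)
      · rfl
  rw [h, (LinearMap.iInfKerProjEquiv ℝ (fun _ : Fin m => ℝ) (I := {i : Fin m | (i : ℕ) < j})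
    (J := {i : Fin m | j ≤ i}) (by
      rw [disjoint_left]
      intro i h1 h2
      simp only [mem_ofPred_eq] at h1 h2
      omega) (fun i _ => by
        simp only [mem_union, mem_ofPred_eq]
        omega)).finrank_eq, Module.finrank_fintype_fun_eq_card]
  rw [min_comm, ← Fin.card_filter_val_lt, Fintype.card_subtype]
  rfl

theorem finrank_ker_jordanBlock_sub_pow_of_ne {a b : ℝ} (hab : a ≠ b) (m j : ℕ) :
    Module.finrank ℝ ((jordanBlock a m - b • 1) ^ j).mulVecLin.ker = 0 := by
  have h : (jordanBlock a m - b • 1).IsUpperTriangular := by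
    intro i k hik
    have hik' : k < i := hik
    simp only [jordanBlock, Matrix.sub_apply, Matrix.of_apply, Matrix.smul_apply, Matrix.one_apply]
    rw [if_neg hik'.ne', if_neg (by have : (k : ℕ) < i := hik'; omega), if_neg hik'.ne']
    simp
  have hdet : ((jordanBlock a m - b • 1) ^ j).det ≠ 0 := by
    rw [Matrix.det_pow, Matrix.det_of_isUpperTriangular h]
    refine pow_ne_zero _ (Finset.prod_ne_zero_iff.mpr fun i _ => ?_)
    simpa [jordanBlock] using sub_ne_zero.mpr hab
  have : ((jordanBlock a m - b • 1) ^ j).mulVecLin.ker = ⊥ := by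
    rw [LinearMap.ker_eq_bot]
    exact Matrix.mulVec_injective_of_isUnit ((Matrix.isUnit_iff_isUnit_det _).mpr hdet.isUnit)
  rw [this, finrank_bot]

theorem finrank_ker_jordanMatrix_sub_pow (f : ι → ℝ × ℕ) (a : ℝ) (j : ℕ) :
    Module.finrank ℝ ((jordanMatrix f - a • 1) ^ j).mulVecLin.ker
      = ∑ x, if (f x).1 = a then min j (f x).2 else 0 := by
  have h : (jordanMatrix f - a • 1) ^ j
      = Matrix.blockDiagonal' fun x => (jordanBlock (f x).1 (f x).2 - a • 1) ^ j := by
    rw [jordanMatrix, ← Matrix.blockDiagonal'_one, ← Matrix.blockDiagonal'_smul,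
      ← Matrix.blockDiagonal'_sub, ← Matrix.blockDiagonal'_pow]
    rfl
  rw [h, finrank_ker_blockDiagonal']
  refine Finset.sum_congr rfl fun x _ => ?_
  split_ifs with hx
  · rw [← hx, finrank_ker_jordanBlock_sub_pow]
  · rw [finrank_ker_jordanBlock_sub_pow_of_ne hx]

/-- The negative second difference of `j ↦ min j k`, centred at `m + 1`, is `1` for `k = m + 1` and
`0` otherwise. Kernel dimensions therefore count the blocks of each positive size. -/
theorem Multiset.eq_of_sum_min_eq {s t : Multiset (ℝ × ℕ)} (hs : ∀ x ∈ s, 0 < x.2)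
    (ht : ∀ x ∈ t, 0 < x.2)
    (h : ∀ (a : ℝ) (j : ℕ), (s.map fun x => if x.1 = a then min j x.2 else 0).sum
      = (t.map fun x => if x.1 = a then min j x.2 else 0).sum) : s = t := by
  have key : ∀ (u : Multiset (ℝ × ℕ)) (a : ℝ) (m : ℕ), (u.count (a, m + 1) : ℤ)
      = 2 * ((u.map fun x => if x.1 = a then min (m + 1) x.2 else 0).sum : ℕ)
        - ((u.map fun x => if x.1 = a then min m x.2 else 0).sum : ℕ)
        - ((u.map fun x => if x.1 = a then min (m + 2) x.2 else 0).sum : ℕ) := by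
    intro u a m
    induction u using Multiset.induction_on with
    | empty => simp
    | cons x u ih =>
      simp only [Multiset.count_cons, Multiset.map_cons, Multiset.sum_cons]
      push_cast at ih ⊢
      rw [ih]
      obtain ⟨b, k⟩ := x
      by_cases hb : b = a
      · subst hb
        simp only [Prod.mk.injEq, true_and, if_true]
        split_ifs with hk <;> omega
      · have hb' : ¬ (a, m + 1) = (b, k) := fun e => hb (Prod.mk.inj e).1.symm
        simp only [hb, hb', if_false]
        ring
  ext ⟨a, m⟩
  rcases m with _ | m
  · rw [Multiset.count_eq_zero.mpr fun hx => absurd (hs _ hx) (lt_irrefl 0),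
      Multiset.count_eq_zero.mpr fun hx => absurd (ht _ hx) (lt_irrefl 0)]
  · have := key s a m
    rw [h, h, h, ← key t a m] at this
    exact_mod_cast this

end JordanMatrix

/-- Equal multisets of values mean fibres of equal cardinality, and bijections of the fibres glue
together. -/
theorem exists_equiv_of_map_univ_eq {ι κ α : Type*} [Fintype ι] [Fintype κ] [DecidableEq α]
    {f : ι → α} {g : κ → α} (h : Finset.univ.val.map f = Finset.univ.val.map g) :
    ∃ σ : ι ≃ κ, f = g ∘ σ := by
  have key : ∀ y, Nonempty ({x // f x = y} ≃ {x // g x = y}) := fun y => by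
    rw [← Fintype.card_eq, Fintype.card_subtype, Fintype.card_subtype]
    have := congrArg (Multiset.count y) h
    rw [Multiset.count_map, Multiset.count_map] at this
    simp only [eq_comm (a := y)] at this
    exact this
  let τ := (Equiv.sigmaFiberEquiv f).symm.trans
    ((Equiv.sigmaCongrRight fun y => (key y).some).trans (Equiv.sigmaFiberEquiv g))
  refine ⟨τ, funext fun x => ?_⟩
  exact ((key (f x)).some ⟨x, rfl⟩).2.symm

theorem jordanMatrix_comp_equiv {ι κ : Type*} [DecidableEq ι] [DecidableEq κ] (σ : ι ≃ κ) 
    (g : κ → ℝ × ℕ) :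
    ∃ e : (Σ x, Fin (g (σ x)).2) ≃ Σ y, Fin (g y).2,
      Matrix.reindex e e (jordanMatrix (g ∘ σ)) = jordanMatrix g := by
  refine ⟨Equiv.sigmaCongrLeft (β := fun y => Fin (g y).2) σ, ?_⟩
  rw [← Equiv.eq_symm_apply]
  ext ⟨x, i⟩ ⟨y, j⟩
  simp only [Matrix.reindex_symm, Matrix.reindex_apply, Matrix.submatrix_apply, Equiv.symm_symm,
    Equiv.sigmaCongrLeft_apply]
  by_cases h : x = y
  · subst h
    simp only [jordanMatrix, Matrix.blockDiagonal'_apply_eq, Function.comp]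
  · rw [jordanMatrix, jordanMatrix, Matrix.blockDiagonal'_apply_ne _ _ _ h,
      Matrix.blockDiagonal'_apply_ne _ _ _ fun e => h (σ.injective e)]

theorem exists_blockDiag_blockDiag_eq {k : ℕ} {c : Fin k → ℕ} {d : ∀ i, Fin (c i) → ℕ}
    (M : ∀ i j, Matrix (Fin (d i j)) (Fin (d i j)) ℝ) :
    ∃ e : (Σ x : Σ i, Fin (c i), Fin (d x.1 x.2)) ≃ Fin (∑ i, ∑ j, d i j),
      blockDiag (fun i => blockDiag (M i))
        = Matrix.reindex e e (Matrix.blockDiagonal' fun x : Σ i, Fin (c i) => M x.1 x.2) := by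
  refine ⟨(Equiv.sigmaAssoc fun i j => Fin (d i j)).trans
    ((Equiv.sigmaCongrRight fun i => finSigmaFinEquiv).trans finSigmaFinEquiv), ?_⟩
  rw [← Equiv.symm_apply_eq]
  ext ⟨⟨x, i⟩, a⟩ ⟨⟨y, j⟩, b⟩
  have key : ∀ (x : Fin k) (i : Fin (c x)) (a : Fin (d x i)),
      ((Equiv.sigmaAssoc fun i j => Fin (d i j)).trans
        ((Equiv.sigmaCongrRight fun i => finSigmaFinEquiv).trans finSigmaFinEquiv)) ⟨⟨x, i⟩, a⟩
      = finSigmaFinEquiv ⟨x, finSigmaFinEquiv ⟨i, a⟩⟩ := fun _ _ _ => rfl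
  rw [Matrix.reindex_symm, Matrix.reindex_apply, Matrix.submatrix_apply, Equiv.symm_symm, key, key,
    blockDiag, Matrix.reindex_apply, Matrix.submatrix_apply, Equiv.symm_apply_apply,
    Equiv.symm_apply_apply]
  by_cases hxy : x = y
  · subst hxy
    rw [Matrix.blockDiagonal'_apply_eq, blockDiag, Matrix.reindex_apply, Matrix.submatrix_apply,
      Equiv.symm_apply_apply, Equiv.symm_apply_apply]
    by_cases hij : i = j
    · subst hij
      rw [Matrix.blockDiagonal'_apply_eq, Matrix.blockDiagonal'_apply_eq]
    · rw [Matrix.blockDiagonal'_apply_ne _ _ _ hij, Matrix.blockDiagonal'_apply_ne]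
      intro e
      exact hij (by simpa using e)
  · rw [Matrix.blockDiagonal'_apply_ne _ _ _ hxy, Matrix.blockDiagonal'_apply_ne]
    intro e
    exact hxy (Sigma.mk.inj e).1

theorem Multiset.map_univ_get {α : Type*} (l : List α) :
    (Finset.univ : Finset (Fin l.length)).val.map l.get = (l : Multiset α) := by
  rw [Fin.univ_val_map, List.ofFn_get]

/-! ### Parameters as multisets of blocks -/

namespace JordanParams

/-- The index type of the Jordan blocks. -/
abbrev Index (p : JordanParams n) : Type := Σ i : Fin p.k, Fin (partsList (p.part i)).length

/-- The eigenvalue and the size of a Jordan block. -/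
def block (p : JordanParams n) (x : p.Index) : ℝ × ℕ :=
  (p.eig x.1, (partsList (p.part x.1)).get x.2)

/-- The multiset of the eigenvalues and the sizes of all Jordan blocks. -/
def blocks (p : JordanParams n) : Multiset (ℝ × ℕ) :=
  ∑ i, (p.part i).parts.map (Prod.mk (p.eig i))

theorem map_block (p : JordanParams n) : Finset.univ.val.map p.block = p.blocks := by
  rw [← Finset.sum_multiset_singleton, ← Multiset.coe_mapAddMonoidHom, map_sum,
    Fintype.sum_sigma, blocks]
  refine Finset.sum_congr rfl fun i _ => ?_
  have h1 := Multiset.map_univ_get (partsList (p.part i))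
  rw [partsList, Multiset.sort_eq, ← partsList] at h1
  rw [← h1]
  rw [Multiset.map_map, ← Finset.sum_multiset_singleton, ← Multiset.coe_mapAddMonoidHom, map_sum]
  rfl

theorem exists_matrix_eq (p : JordanParams n) :
    ∃ e : (Σ x, Fin (p.block x).2) ≃ Fin n, p.matrix = Matrix.reindex e e (jordanMatrix p.block) := by
  have h : ∑ i, ∑ j, (partsList (p.part i)).get j = n := by
    simp only [sum_partsList, p.sum_mult]
  obtain ⟨e, he⟩ := exists_blockDiag_blockDiag_eq fun i j =>
    jordanBlock (p.eig i) ((partsList (p.part i)).get j)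
  refine ⟨e.trans (finCongr h), ?_⟩
  have : p.matrix = Matrix.reindex (finCongr h) (finCongr h) (blockDiag fun i => blockDiag fun j =>
    jordanBlock (p.eig i) ((partsList (p.part i)).get j)) := rfl
  rw [this, he]
  rfl

theorem mem_blocks {p : JordanParams n} {x : ℝ × ℕ} :
    x ∈ p.blocks ↔ ∃ i, p.eig i = x.1 ∧ x.2 ∈ (p.part i).parts := by
  obtain ⟨a, m⟩ := x
  simp only [blocks, Multiset.mem_sum, Multiset.mem_map, Finset.mem_univ, true_and, Prod.mk.injEq]
  constructor
  · rintro ⟨i, m', hm, rfl, rfl⟩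
    exact ⟨i, rfl, hm⟩
  · rintro ⟨i, rfl, hm⟩
    exact ⟨i, m, hm, rfl, rfl⟩

theorem snd_pos_of_mem_blocks (p : JordanParams n) : ∀ x ∈ p.blocks, 0 < x.2 := fun x hx => by
  obtain ⟨i, -, h⟩ := mem_blocks.mp hx
  exact (p.part i).parts_pos h

theorem range_eig (p : JordanParams n) : range p.eig = {a | ∃ m, (a, m) ∈ p.blocks} := by
  ext a
  simp only [mem_range, mem_ofPred_eq, mem_blocks]
  constructor
  · rintro ⟨i, rfl⟩
    have h : (p.part i).parts ≠ 0 := fun h0 => by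
      have := (p.part i).parts_sum
      rw [h0, Multiset.sum_zero] at this
      exact (p.mult_pos i).ne this
    obtain ⟨m, hm⟩ := Multiset.exists_mem_of_ne_zero h
    exact ⟨m, i, rfl, hm⟩
  · rintro ⟨m, i, h, -⟩
    exact ⟨i, h⟩

theorem parts_part (p : JordanParams n) (i : Fin p.k) :
    (p.part i).parts = (p.blocks.filter fun x => x.1 = p.eig i).map Prod.snd := by
  have h : p.blocks.filter (fun x => x.1 = p.eig i) = (p.part i).parts.map (Prod.mk (p.eig i)) := by
    let φ : Multiset (ℝ × ℕ) →+ Multiset (ℝ × ℕ) :=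
      { toFun := Multiset.filter fun x => x.1 = p.eig i
        map_zero' := Multiset.filter_zero _
        map_add' := Multiset.filter_add _ }
    change φ p.blocks = _
    rw [blocks, map_sum, Finset.sum_eq_single i]
    · refine Multiset.filter_eq_self.mpr ?_
      simp
    · intro j _ hj
      refine Multiset.filter_eq_nil.mpr ?_
      simp only [Multiset.mem_map, forall_exists_index, and_imp]
      rintro x m _ rfl h
      exact hj (p.eig_strictMono.injective h)
    · simp
  rw [h, Multiset.map_map]
  simp

/-- The blocks determine the set of eigenvalues, which a strictly increasing enumeration recovers in
order; filtering by an eigenvalue recovers its partition, whose sum is the multiplicity. -/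
theorem blocks_injective : Function.Injective (blocks (n := n)) := by
  intro p q h
  have hr := p.range_eig
  rw [h, ← q.range_eig] at hr
  have hk : p.k = q.k := by
    have h1 := congrArg Set.ncard hr
    rwa [ncard_range_of_injective p.eig_strictMono.injective,
      ncard_range_of_injective q.eig_strictMono.injective, Nat.card_fin, Nat.card_fin] at h1
  have hp := p.parts_part
  have hq := q.parts_part
  rw [h] at hp
  generalize q.blocks = s at hp hq
  obtain ⟨k, mult, h1, h2, eig, h3, h4, h5, h6, part⟩ := p
  obtain ⟨k', mult', h1', h2', eig', h3', h4', h5', h6', part'⟩ := q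
  simp only at hr hk hp hq
  subst hk
  obtain rfl := (h4.range_inj h4').mp hr
  have hpart : ∀ i, (part i).parts = (part' i).parts := fun i => (hp i).trans (hq i).symm
  obtain rfl : mult = mult' := funext fun i => by
    rw [← (part i).parts_sum, hpart, (part' i).parts_sum]
  obtain rfl : part = part' := funext fun i => Nat.Partition.ext (hpart i)
  rfl

theorem exists_blocks_eq {s : Multiset (ℝ × ℕ)} (h₁ : ∀ x ∈ s, 1 < x.1) (h₂ : ∀ x ∈ s, 0 < x.2)
    (hn : (s.map Prod.snd).sum = n) (hs : (s.map fun x => x.1 ^ x.2).prod = 2) :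
    ∃ p : JordanParams n, p.blocks = s := by
  classical
  let L : Finset ℝ := (s.map Prod.fst).toFinset
  let eig : Fin L.card → ℝ := L.orderEmbOfFin rfl
  let P : Fin L.card → Multiset ℕ := fun i => (s.filter fun x => x.1 = eig i).map Prod.snd
  have hL : ∀ a, a ∈ L ↔ ∃ x ∈ s, x.1 = a := fun a => by simp [L]
  have hmem : ∀ i, eig i ∈ L := fun i => Finset.orderEmbOfFin_mem L rfl i
  have hmono : StrictMono eig := (L.orderEmbOfFin rfl).strictMono
  have hPmap : ∀ i, (P i).map (Prod.mk (eig i)) = s.filter fun x => x.1 = eig i := fun i => by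
    rw [Multiset.map_map]
    conv_rhs => rw [← Multiset.map_id (s.filter fun x => x.1 = eig i)]
    refine Multiset.map_congr rfl fun x hx => ?_
    exact Prod.ext (Multiset.mem_filter.mp hx).2.symm rfl
  have hblocks : ∑ i, (P i).map (Prod.mk (eig i)) = s := by
    simp only [hPmap]
    ext x
    rw [Multiset.count_sum']
    simp only [Multiset.count_filter]
    by_cases hx : x ∈ s
    · have : x.1 ∈ range eig := by
        rw [show eig = L.orderEmbOfFin rfl from rfl, Finset.range_orderEmbOfFin]
        exact (hL _).mpr ⟨x, hx, rfl⟩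
      obtain ⟨i, hi⟩ := this
      rw [Finset.sum_eq_single i]
      · rw [if_pos hi.symm]
      · intro j _ hj
        rw [if_neg]
        intro h
        exact hj (hmono.injective (h.symm.trans hi.symm))
      · simp
    · simp [Multiset.count_eq_zero_of_notMem hx]
  have hpos : ∀ i, 0 < (P i).sum := fun i => by
    obtain ⟨x, hx, hxi⟩ := (hL _).mp (hmem i)
    exact (h₂ x hx).trans_le (Multiset.le_sum_of_mem
      (Multiset.mem_map_of_mem _ (Multiset.mem_filter.mpr ⟨hx, hxi⟩)))
  have hsum : ∑ i, (P i).sum = n := by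
    rw [← hn, ← hblocks, ← Multiset.coe_mapAddMonoidHom, map_sum, ← Multiset.coe_sumAddMonoidHom,
      map_sum]
    simp [Multiset.map_map]
  have hone : ∀ i, 1 < eig i := fun i => by
    obtain ⟨x, hx, hxi⟩ := (hL _).mp (hmem i)
    rw [← hxi]
    exact h₁ x hx
  have hprod : ∏ i, eig i ^ (P i).sum = 2 := by
    rw [← hs, ← hblocks, ← Multiset.coe_mapAddMonoidHom, map_sum, Multiset.prod_sum]
    refine Finset.prod_congr rfl fun i _ => ?_
    rw [Multiset.coe_mapAddMonoidHom, Multiset.map_map]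
    generalize P i = t
    induction t using Multiset.induction_on with
    | empty => simp
    | cons m t ih => simp [pow_add, ih]
  refine ⟨⟨L.card, fun i => (P i).sum, hpos, hsum, eig, hone, hmono, fun hn2 i => ?_, hprod,
    fun i => ⟨P i, fun {m} hm => ?_, rfl⟩⟩, hblocks⟩
  -- The bound `eig i < 2`: either there is another eigenvalue, whose factor exceeds `1`, or `eig i`
  -- occurs with multiplicity `n ≥ 2`. In both cases `eig i` is strictly below the full product `2`.
  · rw [← Finset.mul_prod_erase _ _ (Finset.mem_univ i)] at hprod
    rw [← Finset.add_sum_erase _ _ (Finset.mem_univ i)] at hsum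
    have hle : ∀ j, 1 < eig j ^ (P j).sum := fun j => one_lt_pow₀ (hone j) (hpos j).ne'
    have hE : 1 ≤ ∏ j ∈ Finset.univ.erase i, eig j ^ (P j).sum :=
      Finset.prod_induction _ (1 ≤ ·) (fun _ _ => one_le_mul_of_one_le_of_one_le) le_rfl
      fun j _ => (hle j).le
    rcases (Finset.univ.erase i).eq_empty_or_nonempty with hempty | ⟨j, hj⟩
    · rw [hempty, Finset.sum_empty, add_zero] at hsum
      rw [hempty, Finset.prod_empty, mul_one] at hprod
      rw [← hprod]
      exact lt_self_pow₀ (hone i) (by omega)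
    · have h3 : 1 < ∏ j ∈ Finset.univ.erase i, eig j ^ (P j).sum := by
        rw [← Finset.mul_prod_erase _ _ hj]
        exact one_lt_mul_of_lt_of_le (hle j) (Finset.prod_induction _ (1 ≤ ·) (fun _ _ => one_le_mul_of_one_le_of_one_le) le_rfl
      fun j _ => (hle j).le)
      have h4 : eig i ≤ eig i ^ (P i).sum := le_self_pow₀ (hone i).le (hpos i).ne'
      have h5 := hone i
      nlinarith
  · obtain ⟨x, hx, rfl⟩ := Multiset.mem_map.mp hm
    exact h₂ x (Multiset.mem_filter.mp hx).1

open Polynomial in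
theorem charpoly_matrix (p : JordanParams n) :
    p.matrix.charpoly = (p.blocks.map fun x => (X - C x.1) ^ x.2).prod := by
  obtain ⟨e, he⟩ := p.exists_matrix_eq
  rw [he, Matrix.charpoly_reindex, charpoly_jordanMatrix, ← map_block, Multiset.map_map]
  rfl

theorem det_matrix (p : JordanParams n) : p.matrix.det = 2 := by
  obtain ⟨e, he⟩ := p.exists_matrix_eq
  rw [he, Matrix.det_reindex_self, det_jordanMatrix]
  have : ∏ x, (p.block x).1 ^ (p.block x).2 = (p.blocks.map fun x => x.1 ^ x.2).prod := by
    rw [← map_block, Multiset.map_map]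
    rfl
  rw [this, blocks, ← p.prod_eig, ← Multiset.coe_mapAddMonoidHom, map_sum, Multiset.prod_sum]
  refine Finset.prod_congr rfl fun i _ => ?_
  rw [Multiset.coe_mapAddMonoidHom, Multiset.map_map]
  conv_rhs => rw [← (p.part i).parts_sum]
  generalize (p.part i).parts = t
  induction t using Multiset.induction_on with
  | empty => simp
  | cons m t ih =>
    rw [Multiset.map_cons, Multiset.prod_cons, ih, Multiset.sum_cons, pow_add]
    rfl

theorem isDilation_matrix (p : JordanParams n) : IsDilation p.matrix := by
  intro z hz
  rw [Matrix.mem_spectrum_iff_isRoot_charpoly] at hz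
  have h : (p.matrix.map Complex.ofReal).charpoly = p.matrix.charpoly.map Complex.ofRealHom :=
    Matrix.charpoly_map p.matrix Complex.ofRealHom
  rw [h, charpoly_matrix, Polynomial.IsRoot, Polynomial.eval_map, ← Polynomial.coe_eval₂RingHom,
    map_multiset_prod, Multiset.prod_eq_zero_iff, Multiset.mem_map] at hz
  obtain ⟨q, hq, hq0⟩ := hz
  obtain ⟨x, hx, rfl⟩ := Multiset.mem_map.mp hq
  rw [map_pow] at hq0
  have h0 := (pow_eq_zero_iff (snd_pos_of_mem_blocks p x hx).ne').mp hq0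
  simp only [Polynomial.coe_eval₂RingHom, Polynomial.eval₂_sub, Polynomial.eval₂_X,
    Polynomial.eval₂_C, sub_eq_zero] at h0
  obtain ⟨i, hi, -⟩ := mem_blocks.mp hx
  rw [h0, ← hi]
  have := p.one_lt_eig i
  simpa [abs_of_pos (one_pos.trans this)] using this

theorem exists_multiset_aeval_matrix_eq_zero (p : JordanParams n) :
    ∃ s : Multiset ℝ, (∀ a ∈ s, 0 < a) ∧
      Polynomial.aeval p.matrix (s.map fun a => Polynomial.X - Polynomial.C a).prod = 0 := by
  refine ⟨p.blocks.bind fun x => Multiset.replicate x.2 x.1, fun a ha => ?_, ?_⟩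
  · obtain ⟨x, hx, hax⟩ := Multiset.mem_bind.mp ha
    obtain ⟨i, hi, -⟩ := mem_blocks.mp hx
    rw [Multiset.eq_of_mem_replicate hax, ← hi]
    exact one_pos.trans (p.one_lt_eig i)
  · rw [Multiset.map_bind, Multiset.prod_bind]
    simp only [Multiset.map_replicate, Multiset.prod_replicate]
    rw [← charpoly_matrix, Matrix.aeval_self_charpoly]

/-- The ranks of `(A - a) ^ j` determine the parameters. -/
theorem eq_of_mul_matrix_eq {p q : JordanParams n} (S : GL (Fin n) ℝ)
    (h : S.1 * p.matrix = q.matrix * S.1) : p = q := by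
  refine blocks_injective (Multiset.eq_of_sum_min_eq p.snd_pos_of_mem_blocks
    q.snd_pos_of_mem_blocks fun a j => ?_)
  -- By rank-nullity the sum of minima is the corank of `(p.matrix - a) ^ j`, which is a similarity
  -- invariant.
  have key : ∀ p : JordanParams n,
      ((p.matrix - a • 1) ^ j).rank
        + (p.blocks.map fun x => if x.1 = a then min j x.2 else 0).sum = n := by
    intro p
    obtain ⟨e, he⟩ := p.exists_matrix_eq
    have h1 : (p.matrix - a • 1) ^ j = Matrix.reindex e e ((jordanMatrix p.block - a • 1) ^ j) := by
      rw [he]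
      change _ = Matrix.reindexAlgEquiv ℝ ℝ e _
      rw [map_pow, map_sub, map_smul, map_one]
      rfl
    have h2 := LinearMap.finrank_range_add_finrank_ker
      ((jordanMatrix p.block - a • 1) ^ j).mulVecLin
    rw [finrank_ker_jordanMatrix_sub_pow, Module.finrank_fintype_fun_eq_card, Fintype.card_congr e,
      Fintype.card_fin] at h2
    rw [h1, Matrix.rank_reindex, ← map_block, Multiset.map_map]
    exact h2
  have hpow : S.1 * (p.matrix - a • 1) ^ j = (q.matrix - a • 1) ^ j * S.1 := by
    have : SemiconjBy S.1 (p.matrix - a • 1) (q.matrix - a • 1) := by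
      rw [SemiconjBy, mul_sub, sub_mul, h, Matrix.mul_smul, Matrix.smul_mul, mul_one, one_mul]
    exact this.pow_right j
  have hS : IsUnit S.1.det := (Matrix.isUnit_iff_isUnit_det _).mp S.isUnit
  have hrank : ((p.matrix - a • 1) ^ j).rank = ((q.matrix - a • 1) ^ j).rank := by
    rw [← Matrix.rank_mul_eq_right_of_isUnit_det S.1 _ hS, hpow,
      Matrix.rank_mul_eq_left_of_isUnit_det S.1 _ hS]
  have hp := key p
  have hq := key q
  omega

end JordanParams

/-! ### Real Jordan form from modules over polynomials -/

-- The basis consists of the classes of `(X - a) ^ (m - 1 - i)`: multiplication by `X - a` lowers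
-- the index and kills index `0`. Taylor expansion at `a` shows that they span, and counting
-- dimensions does the rest.
open Polynomial in
theorem quotient_exists_jordan_basis (a : ℝ) (m : ℕ) :
    ∃ b : Module.Basis (Fin m) ℝ (ℝ[X] ⧸ Submodule.span ℝ[X] {(X - C a) ^ m}),
      ∀ i, (X : ℝ[X]) • b i
        = C a • b i + if h : (i : ℕ) = 0 then 0 else b ⟨i - 1, by omega⟩ := by
  let I : Ideal ℝ[X] := Submodule.span ℝ[X] {(X - C a) ^ m}
  let v : Fin m → ℝ[X] ⧸ I := fun i => Submodule.Quotient.mk ((X - C a) ^ (m - 1 - i))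
  have hzero : ∀ j, m ≤ j → (Submodule.Quotient.mk ((X - C a) ^ j) : ℝ[X] ⧸ I) = 0 := by
    intro j hj
    rw [Submodule.Quotient.mk_eq_zero]
    exact Ideal.mem_span_singleton.mpr (pow_dvd_pow _ hj)
  have hspan : ⊤ ≤ Submodule.span ℝ (range v) := by
    rintro x -
    obtain ⟨f, rfl⟩ := Submodule.Quotient.mk_surjective I x
    rw [← sum_taylor_eq f a, Polynomial.sum, ← Submodule.mkQ_apply, map_sum]
    refine Submodule.sum_mem _ fun j _ => ?_
    rw [← smul_eq_C_mul, Submodule.mkQ_apply, Submodule.Quotient.mk_smul]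
    refine Submodule.smul_mem _ _ ?_
    rcases lt_or_ge j m with hj | hj
    · refine Submodule.subset_span ⟨⟨m - 1 - j, by omega⟩, ?_⟩
      simp only [v]
      congr 2
      omega
    · rw [hzero j hj]
      exact Submodule.zero_mem _
  have hfin : Module.Finite ℝ (ℝ[X] ⧸ I) := 
    ⟨Submodule.fg_def.mpr ⟨range v, finite_range v, top_le_iff.mp hspan⟩⟩
  have hcard : Fintype.card (Fin m) = Module.finrank ℝ (ℝ[X] ⧸ I) := by
    have : Module.finrank ℝ (ℝ[X] ⧸ I) = _ :=
      finrank_quotient_span_eq_natDegree (f := (X - C a) ^ m)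
    rw [this, natDegree_pow, natDegree_X_sub_C, mul_one, Fintype.card_fin]
  refine ⟨basisOfTopLeSpanOfCardEqFinrank v hspan hcard, fun i => ?_⟩
  simp only [coe_basisOfTopLeSpanOfCardEqFinrank]
  rw [← sub_eq_iff_eq_add', ← sub_smul]
  simp only [v]
  rw [← Submodule.Quotient.mk_smul, smul_eq_mul, ← pow_succ']
  split_ifs with h
  · exact hzero _ (by omega)
  · congr 2
    omega

theorem DFinsupp.basis_apply_mk {ι R : Type*} {M : ι → Type*} [DecidableEq ι] [Semiring R]
    [∀ i, AddCommMonoid (M i)] [∀ i, Module R (M i)] {η : ι → Type*}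
    (b : ∀ i, Module.Basis (η i) R (M i)) (i : ι) (j : η i) :
    DFinsupp.basis b ⟨i, j⟩ = DFinsupp.single i (b i j) := by
  rw [Module.Basis.apply_eq_iff]
  change (sigmaFinsuppLequivDFinsupp R).symm
    (DFinsupp.mapRange.linearEquiv (fun i => (b i).repr) (DFinsupp.single i (b i j))) = _
  rw [LinearEquiv.symm_apply_eq, DFinsupp.mapRange.linearEquiv_apply, DFinsupp.mapRange_single,
    Module.Basis.repr_self]
  exact (sigmaFinsuppEquivDFinsupp_single ⟨i, j⟩ (1 : R)).symm

open Polynomial DirectSum in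
/-- An endomorphism annihilated by a split polynomial has a Jordan basis. -/
theorem exists_jordan_basis {V : Type} [AddCommGroup V] [Module ℝ V] [FiniteDimensional ℝ V]
    (f : Module.End ℝ V) (s : Multiset ℝ)
    (hf : aeval f (s.map fun a => X - C a).prod = 0) :
    ∃ (ι : Type) (_ : Fintype ι) (g : ι → ℝ × ℕ) (b : Module.Basis (Σ x, Fin (g x).2) ℝ V),
      (∀ x, 0 < (g x).2 → (g x).1 ∈ s) ∧
      ∀ x i, f (b ⟨x, i⟩) = (g x).1 • b ⟨x, i⟩
        + if h : (i : ℕ) = 0 then 0 else b ⟨x, ⟨i - 1, by omega⟩⟩ := by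
  classical
  -- The space with `X` acting as `f` is a torsion module over a principal ideal domain, hence a
  -- direct sum of cyclic modules of prime power order.
  obtain ⟨ι, hι, p, hp, e, ⟨φ⟩⟩ := Module.equiv_directSum_of_isTorsion
    (Module.AEval.isTorsion_of_finiteDimensional ℝ V f)
  have hkill : ∀ m : Module.AEval ℝ V f, (s.map fun a => X - C a).prod • m = 0 := fun m => by
    obtain ⟨v, rfl⟩ := (Module.AEval.of ℝ V f).surjective m
    rw [← Module.AEval.of_aeval_smul, hf, zero_smul, map_zero]
  have hroot : ∀ i, ∃ a : ℝ, (0 < e i → a ∈ s) ∧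
      Submodule.span ℝ[X] {p i ^ e i} = Submodule.span ℝ[X] {(X - C a) ^ e i} := by
    intro i
    rcases Nat.eq_zero_or_pos (e i) with h0 | h0
    -- A summand with exponent zero is trivial, so any value serves as its eigenvalue.
    · exact ⟨0, by omega, by simp [h0]⟩
    -- The split polynomial annihilates the generator of the summand, so the prime `p i` divides it
    -- and must be associated to one of its linear factors.
    have h1 : p i ^ e i ∣ (s.map fun a => X - C a).prod := by
      let w : ⨁ i, ℝ[X] ⧸ ℝ[X] ∙ p i ^ e i :=
        DirectSum.lof ℝ[X] ι (fun i => ℝ[X] ⧸ ℝ[X] ∙ p i ^ e i) i (Submodule.Quotient.mk 1)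
      have h2 : (s.map fun a => X - C a).prod • w = 0 := by
        rw [← φ.apply_symm_apply w, ← map_smul, hkill, map_zero]
      have h3 := congrArg (DirectSum.component ℝ[X] ι _ i) h2
      rw [map_smul, DirectSum.component.lof_self, map_zero, ← Submodule.Quotient.mk_smul,
        Submodule.Quotient.mk_eq_zero, smul_eq_mul, mul_one] at h3
      exact Ideal.mem_span_singleton.mp h3
    obtain ⟨a, ha, hdvd⟩ := (hp i).prime.exists_mem_multiset_map_dvd
      ((dvd_pow_self _ h0.ne').trans h1)
    have h4 := ((hp i).associated_of_dvd (irreducible_X_sub_C a) hdvd).pow_pow (n := e i)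
    exact ⟨a, fun _ => ha, Ideal.span_singleton_eq_span_singleton.mpr h4⟩
  choose a ha hspan using hroot
  have hb : ∀ i, ∃ b : Module.Basis (Fin (e i)) ℝ (ℝ[X] ⧸ ℝ[X] ∙ p i ^ e i),
      ∀ j, (X : ℝ[X]) • b j
        = C (a i) • b j + if h : (j : ℕ) = 0 then 0 else b ⟨j - 1, by omega⟩ := fun i => by
    rw [hspan i]
    exact quotient_exists_jordan_basis (a i) (e i)
  choose b hb using hb
  let B : Module.Basis (Σ i, Fin (e i)) ℝ (⨁ i, ℝ[X] ⧸ ℝ[X] ∙ p i ^ e i) := DFinsupp.basis b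
  let ψ := (Module.AEval.of ℝ V f).trans (φ.restrictScalars ℝ)
  have hψ : ∀ v, ψ (f v) = (X : ℝ[X]) • ψ v := fun v => by
    have := Module.AEval.X_smul_of (R := ℝ) f v
    change φ (Module.AEval.of ℝ V f (f • v)) = X • φ (Module.AEval.of ℝ V f v)
    rw [← this, map_smul]
  have hB : ∀ i j, B ⟨i, j⟩ = DirectSum.lof ℝ[X] ι (fun i => ℝ[X] ⧸ ℝ[X] ∙ p i ^ e i) i (b i j) := by
    intro i j
    exact DFinsupp.basis_apply_mk b i j
  refine ⟨ι, hι, fun i => (a i, e i), B.map ψ.symm, ha, fun i j => ?_⟩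
  apply ψ.injective
  simp only [hψ, map_add, map_smul, Module.Basis.map_apply, LinearEquiv.apply_symm_apply]
  rw [hB, ← map_smul, hb, map_add, map_smul]
  congr 1
  · rw [C_eq_algebraMap, algebraMap_smul]
  · split_ifs with h
    · simp
    · rw [LinearEquiv.apply_symm_apply, hB]

theorem exists_basis_toMatrix_eq_jordanMatrix {V : Type} [AddCommGroup V] [Module ℝ V]
    [FiniteDimensional ℝ V] (f : Module.End ℝ V) (s : Multiset ℝ)
    (hf : Polynomial.aeval f (s.map fun a => Polynomial.X - Polynomial.C a).prod = 0) :
    ∃ (ι : Type) (_ : Fintype ι) (_ : DecidableEq ι) (g : ι → ℝ × ℕ)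
      (b : Module.Basis (Σ x, Fin (g x).2) ℝ V), (∀ x, (g x).1 ∈ s) ∧ (∀ x, 0 < (g x).2) ∧
      LinearMap.toMatrix b b f = jordanMatrix g := by
  classical
  obtain ⟨ι, hι, g, b, hg, hb⟩ := exists_jordan_basis f s hf
  -- Empty blocks contribute no indices and are discarded, since partitions have positive parts.
  let τ : (Σ x : {x // 0 < (g x).2}, Fin (g x.1).2) ≃ Σ x, Fin (g x).2 :=
    { toFun := fun x => ⟨x.1.1, x.2⟩
      invFun := fun x => ⟨⟨x.1, x.2.pos⟩, x.2⟩
      left_inv := fun _ => rfl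
      right_inv := fun _ => rfl }
  refine ⟨{x // 0 < (g x).2}, inferInstance, inferInstance, fun x => g x.1, b.reindex τ.symm,
    fun x => hg _ x.2, fun x => x.2, ?_⟩
  ext ⟨x, i⟩ ⟨y, j⟩
  rw [LinearMap.toMatrix_apply, Module.Basis.reindex_apply, Equiv.symm_symm]
  change (b.reindex τ.symm).repr (f (b ⟨y.1, j⟩)) _ = _
  rw [hb, map_add, map_smul, Module.Basis.repr_reindex, Module.Basis.repr_reindex, Finsupp.add_apply,
    Finsupp.smul_apply, Finsupp.mapDomain_equiv_apply, Finsupp.mapDomain_equiv_apply,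
    Equiv.symm_symm, Module.Basis.repr_self]
  change _ • (Finsupp.single (⟨y.1, j⟩ : Σ x, Fin (g x).2) (1 : ℝ)) ⟨x.1, i⟩
    + (b.repr _) ⟨x.1, i⟩ = _
  by_cases hxy : x = y
  · subst hxy
    rw [jordanMatrix, Matrix.blockDiagonal'_apply_eq, jordanBlock, Matrix.of_apply]
    by_cases hij : i = j
    · subst hij
      rw [if_pos rfl, Finsupp.single_eq_same]
      split_ifs with h0
      · simp
      · rw [Module.Basis.repr_self, Finsupp.single_eq_of_ne]
        · simp
        · simp only [ne_eq, Sigma.mk.injEq, heq_eq_eq, true_and, Fin.ext_iff]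
          omega
    · rw [if_neg hij, Finsupp.single_eq_of_ne (by simpa using hij), smul_zero, zero_add]
      split_ifs with h0 h1 h1
      · omega
      · simp
      · rw [Module.Basis.repr_self]
        have : (⟨(j : ℕ) - 1, by omega⟩ : Fin (g x.1).2) = i := Fin.ext (by simp only; omega)
        rw [this, Finsupp.single_eq_same]
      · rw [Module.Basis.repr_self, Finsupp.single_eq_of_ne]
        simp only [ne_eq, Sigma.mk.injEq, heq_eq_eq, true_and, Fin.ext_iff]
        omega
  · have hne : ∀ k, (⟨x.1, i⟩ : Σ x, Fin (g x).2) ≠ ⟨y.1, k⟩ := fun k e =>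
      hxy (Subtype.ext (Sigma.mk.inj e).1)
    rw [jordanMatrix, Matrix.blockDiagonal'_apply_ne _ _ _ hxy, Finsupp.single_eq_of_ne (hne _)]
    split_ifs with h0
    · simp
    · rw [Module.Basis.repr_self, Finsupp.single_eq_of_ne (hne _)]
      simp

/-- A matrix of determinant `2` annihilated by a polynomial that splits with roots larger than `1`
is similar to the matrix of some parameters. -/
theorem exists_jordanParams_mul_eq {Q : Matrix (Fin n) (Fin n) ℝ} {s : Multiset ℝ}
    (hs : ∀ a ∈ s, 1 < a) (hdet : Q.det = 2)
    (hQ : Polynomial.aeval Q (s.map fun a => Polynomial.X - Polynomial.C a).prod = 0) :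
    ∃ (p : JordanParams n) (S : GL (Fin n) ℝ), S.1 * Q = p.matrix * S.1 := by
  have hQ' : Polynomial.aeval (Matrix.toLinAlgEquiv' Q)
      (s.map fun a => Polynomial.X - Polynomial.C a).prod = 0 := by
    rw [Polynomial.aeval_algEquiv, AlgHom.comp_apply, hQ, map_zero]
  obtain ⟨ι, hι, hdec, g, b, hgs, hg, hb⟩ := exists_basis_toMatrix_eq_jordanMatrix _ s hQ'
  have hcard : ∑ x, (g x).2 = n := by
    have := Module.finrank_eq_card_basis b
    rw [Module.finrank_fintype_fun_eq_card, Fintype.card_fin, Fintype.card_sigma] at this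
    simpa using this.symm
  have hprod : ∏ x, (g x).1 ^ (g x).2 = 2 := by
    rw [← det_jordanMatrix, ← hb, LinearMap.det_toMatrix, ← hdet]
    exact LinearMap.det_toLin' Q
  obtain ⟨p, hp⟩ := JordanParams.exists_blocks_eq (n := n) (s := Finset.univ.val.map g)
    (fun x hx => by
      obtain ⟨i, -, rfl⟩ := Multiset.mem_map.mp hx
      exact hs _ (hgs i))
    (fun x hx => by
      obtain ⟨i, -, rfl⟩ := Multiset.mem_map.mp hx
      exact hg i)
    (by
      rw [Multiset.map_map]
      exact hcard)
    (by
      rw [Multiset.map_map]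
      exact hprod)
  obtain ⟨e, he⟩ := p.exists_matrix_eq
  rw [← p.map_block] at hp
  obtain ⟨σ, hσ⟩ := exists_equiv_of_map_univ_eq hp
  obtain ⟨E, hE⟩ : ∃ E : (Σ x, Fin (g x).2) ≃ Fin n,
      p.matrix = Matrix.reindex E E (jordanMatrix g) := by
    rw [he]
    clear he
    generalize p.block = β at e hσ
    subst hσ
    obtain ⟨e', he'⟩ := jordanMatrix_comp_equiv σ g
    refine ⟨e'.symm.trans e, ?_⟩
    rw [← he']
    ext i j
    simp [Matrix.reindex_apply, Matrix.submatrix_apply]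
  let c := b.reindex E
  have hc : LinearMap.toMatrix c c (Matrix.toLin' Q) = p.matrix := by
    rw [hE, ← hb]
    ext i j
    simp [c, LinearMap.toMatrix_apply, Matrix.reindex_apply, Finsupp.mapDomain_equiv_apply]
  let d := Pi.basisFun ℝ (Fin n)
  have hd : LinearMap.toMatrix d d (Matrix.toLin' Q) = Q := by
    rw [LinearMap.toMatrix_eq_toMatrix', LinearMap.toMatrix'_toLin']
  -- The change of basis matrices between the standard and the Jordan basis give the conjugating
  -- element and its inverse.
  have h1 : LinearMap.toMatrix d c LinearMap.id * LinearMap.toMatrix c d LinearMap.id = 1 := by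
    rw [← LinearMap.toMatrix_comp, LinearMap.id_comp, LinearMap.toMatrix_id]
  have h2 : LinearMap.toMatrix c d LinearMap.id * LinearMap.toMatrix d c LinearMap.id = 1 := by
    rw [← LinearMap.toMatrix_comp, LinearMap.id_comp, LinearMap.toMatrix_id]
  refine ⟨p, ⟨_, _, h1, h2⟩, ?_⟩
  change LinearMap.toMatrix d c LinearMap.id * Q = p.matrix * LinearMap.toMatrix d c LinearMap.id
  nth_rw 1 [← hd]
  rw [← hc, ← LinearMap.toMatrix_comp, ← LinearMap.toMatrix_comp, LinearMap.id_comp,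
    LinearMap.comp_id]

/-! ### Real powers of unipotent matrices -/

theorem Commute.aeval_right {R : Type*} [CommSemiring R] {A : Type*} [Semiring A] [Algebra R A]
    {a b : A} (h : Commute a b) (f : Polynomial R) : Commute a (Polynomial.aeval b f) := by
  induction f using Polynomial.induction_on' with
  | add p q hp hq =>
    rw [map_add]
    exact hp.add_right hq
  | monomial k r =>
    rw [Polynomial.aeval_monomial]
    exact (Algebra.commute_algebraMap_right r a).mul_right (h.pow_right k)

section UnipotentPow

variable {K : ℕ} {N : Matrix (Fin n) (Fin n) ℝ}

/-- The real power `(1 + N) ^ t` of a unipotent matrix with `N ^ K = 0`, by the binomial series. -/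
noncomputable def unipotentPow (K : ℕ) (N : Matrix (Fin n) (Fin n) ℝ) (t : ℝ) :
    Matrix (Fin n) (Fin n) ℝ :=
  Polynomial.aeval N (PowerSeries.trunc K (PowerSeries.binomialSeries ℝ t))

/-- Truncation alters a polynomial only by a multiple of `X ^ K`, which vanishes at `N`. Identities
of binomial series thereby pass to `unipotentPow`. -/
theorem aeval_trunc_coe (hN : N ^ K = 0) (p : Polynomial ℝ) :
    Polynomial.aeval N (PowerSeries.trunc K (p : PowerSeries ℝ)) = Polynomial.aeval N p := by
  have h : Polynomial.X ^ K ∣ p - PowerSeries.trunc K (p : PowerSeries ℝ) := by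
    rw [Polynomial.X_pow_dvd_iff]
    intro d hd
    rw [Polynomial.coeff_sub, PowerSeries.coeff_trunc, if_pos hd, Polynomial.coeff_coe, sub_self]
  obtain ⟨q, hq⟩ := h
  have := congrArg (Polynomial.aeval N) hq
  rw [map_sub, map_mul, map_pow, Polynomial.aeval_X, hN, zero_mul, sub_eq_zero] at this
  exact this.symm

theorem unipotentPow_add (hN : N ^ K = 0) (s t : ℝ) :
    unipotentPow K N (s + t) = unipotentPow K N s * unipotentPow K N t := by
  rw [unipotentPow, PowerSeries.binomialSeries_add, ← PowerSeries.trunc_trunc_mul_trunc,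
    ← Polynomial.coe_mul, aeval_trunc_coe hN, map_mul, unipotentPow, unipotentPow]

theorem unipotentPow_zero (hN : N ^ K = 0) : unipotentPow K N 0 = 1 := by
  rw [unipotentPow, PowerSeries.binomialSeries_zero, ← Polynomial.coe_one, aeval_trunc_coe hN,
    map_one]

theorem unipotentPow_one (hN : N ^ K = 0) : unipotentPow K N 1 = 1 + N := by
  have h := PowerSeries.binomialSeries_nat (R := ℝ) (A := ℝ) 1
  rw [Nat.cast_one, pow_one, ← Polynomial.coe_X, ← Polynomial.coe_one, ← Polynomial.coe_add] at h
  rw [unipotentPow, h, aeval_trunc_coe hN, map_add, map_one, Polynomial.aeval_X]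

theorem isUnit_det_unipotentPow (hN : N ^ K = 0) (t : ℝ) : IsUnit (unipotentPow K N t).det := by
  have h : unipotentPow K N t * unipotentPow K N (-t) = 1 := by
    rw [← unipotentPow_add hN, add_neg_cancel, unipotentPow_zero hN]
  exact Matrix.isUnit_det_of_right_inverse h

theorem unipotentPow_zpow (hN : N ^ K = 0) (t : ℝ) (k : ℤ) :
    unipotentPow K N t ^ k = unipotentPow K N (k * t) := by
  have hu := isUnit_det_unipotentPow hN t
  induction k with
  | zero => simp [unipotentPow_zero hN]
  | succ k ih =>
    rw [Matrix.zpow_add_one hu, ih, ← unipotentPow_add hN]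
    congr 1
    push_cast
    ring
  | pred k ih =>
    have h : unipotentPow K N (((-k - 1 : ℤ) : ℝ) * t) * unipotentPow K N t
        = unipotentPow K N (((-k : ℤ) : ℝ) * t) := by
      rw [← unipotentPow_add hN]
      congr 1
      push_cast
      ring
    rw [Matrix.zpow_sub_one hu, ih, ← h, Matrix.mul_nonsing_inv_cancel_right _ _ hu]

theorem commute_unipotentPow {M : Matrix (Fin n) (Fin n) ℝ} (h : Commute M N) (K : ℕ) (t : ℝ) :
    Commute M (unipotentPow K N t) :=
  h.aeval_right _

/-- The binomial series has constant term `1`, so the difference is `N` times a polynomial in `N`.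
For `K = 0` there is no constant term, but then the matrix ring is trivial. -/
theorem isNilpotent_unipotentPow_sub_one (hN : N ^ K = 0) (t : ℝ) :
    IsNilpotent (unipotentPow K N t - 1) := by
  rcases Nat.eq_zero_or_pos K with rfl | hK
  · have h0 : (1 : Matrix (Fin n) (Fin n) ℝ) = 0 := by simpa using hN
    exact ⟨1, by rw [pow_one, ← mul_one (unipotentPow 0 N t - 1), h0, mul_zero]⟩
  have h : Polynomial.X ∣ PowerSeries.trunc K (PowerSeries.binomialSeries ℝ t) - 1 := by
    rw [Polynomial.X_dvd_iff, Polynomial.coeff_sub, PowerSeries.coeff_trunc, if_pos hK,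
      PowerSeries.coeff_zero_eq_constantCoeff, PowerSeries.binomialSeries_constantCoeff,
      Polynomial.coeff_one_zero, sub_self]
  obtain ⟨q, hq⟩ := h
  have := congrArg (Polynomial.aeval N) hq
  rw [map_sub, map_mul, map_one, Polynomial.aeval_X] at this
  rw [unipotentPow, this]
  exact ((Commute.refl N).aeval_right q).isNilpotent_mul_right ⟨K, hN⟩

theorem continuous_ring_choose (k : ℕ) : Continuous fun t : ℝ => Ring.choose t k := by
  have : (fun t : ℝ => Ring.choose t k)
      = fun t => ((k.factorial : ℝ)⁻¹) • (descPochhammer ℤ k).smeval t :=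
    funext fun t => Ring.choose_eq_smul
  rw [this]
  simp only [Polynomial.smeval_eq_sum, Polynomial.sum, Polynomial.smul_pow]
  fun_prop

theorem continuous_unipotentPow (K : ℕ) (N : Matrix (Fin n) (Fin n) ℝ) :
    Continuous (unipotentPow K N) := by
  have : unipotentPow K N
      = fun t => ∑ j ∈ Finset.range (K + 1), (if j < K then Ring.choose t j else 0) • N ^ j := by
    ext1 t
    have h : (PowerSeries.trunc K (PowerSeries.binomialSeries ℝ t)).natDegree < K + 1 :=
      Nat.lt_succ_of_le (Polynomial.natDegree_le_of_degree_le (PowerSeries.degree_trunc_lt _ K).le)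
    rw [unipotentPow, Polynomial.aeval_eq_sum_range' h]
    simp [PowerSeries.coeff_trunc]
  rw [this]
  refine continuous_finsetSum _ fun j _ => ?_
  have hc : Continuous fun t : ℝ => if j < K then Ring.choose t j else 0 := by
    split_ifs
    · exact continuous_ring_choose j
    · exact continuous_const
  exact hc.smul continuous_const

/-- The entries are polynomials in `t`; boundedness for bounded exponents is what controls the
nilpotent parts later. -/
theorem exists_norm_unipotentPow_le (K : ℕ) (N : Matrix (Fin n) (Fin n) ℝ) (R : ℝ) :
    ∃ C, ∀ t, |t| ≤ R → ‖unipotentPow K N t‖ ≤ C := by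
  obtain ⟨C, hC⟩ := (isCompact_Icc (a := -R) (b := R)).exists_bound_of_continuousOn
    (continuous_unipotentPow K N).continuousOn
  exact ⟨C, fun t ht => hC t (abs_le.mp ht)⟩

end UnipotentPow

/-- The characteristic polynomial of `-N` is `X ^ n`; evaluate it at `1`. -/
theorem Matrix.det_one_add_of_isNilpotent {N : Matrix (Fin n) (Fin n) ℝ} (hN : IsNilpotent N) :
    (1 + N).det = 1 := by
  have h := Matrix.isNilpotent_charpoly_sub_pow_of_isNilpotent hN.neg
  rw [isNilpotent_iff_eq_zero, sub_eq_zero] at h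
  have h2 := Matrix.eval_charpoly (-N) 1
  rw [h] at h2
  simpa using h2.symm

/-! ### Complex diagonalization of real matrices -/

section Diagonalization

variable {M M' : Matrix (Fin n) (Fin n) ℝ} {c c' : Fin n → ℂ} {T : GL (Fin n) ℂ}

/-- The columns of `T` are complex eigenvectors of the real matrix `M`, with eigenvalues `c`. -/
def IsDiagonalizedBy (T : GL (Fin n) ℂ) (M : Matrix (Fin n) (Fin n) ℝ) (c : Fin n → ℂ) : Prop :=
  M.map Complex.ofReal * T.1 = T.1 * Matrix.diagonal c

theorem map_ofReal_mul (M M' : Matrix (Fin n) (Fin n) ℝ) :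
    (M * M').map Complex.ofReal = M.map Complex.ofReal * M'.map Complex.ofReal :=
  map_mul Complex.ofRealHom.mapMatrix M M'

theorem map_ofReal_one : (1 : Matrix (Fin n) (Fin n) ℝ).map Complex.ofReal = 1 :=
  map_one Complex.ofRealHom.mapMatrix

namespace IsDiagonalizedBy

theorem one : IsDiagonalizedBy T 1 (fun _ => 1) := by
  rw [IsDiagonalizedBy, map_ofReal_one, one_mul, Matrix.diagonal_one, mul_one]

theorem mul (h : IsDiagonalizedBy T M c) (h' : IsDiagonalizedBy T M' c') :
    IsDiagonalizedBy T (M * M') (c * c') := by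
  unfold IsDiagonalizedBy at *
  rw [map_ofReal_mul, mul_assoc, h', ← mul_assoc, h, mul_assoc, Matrix.diagonal_mul_diagonal]
  rfl

theorem map_eq (h : IsDiagonalizedBy T M c) :
    M.map Complex.ofReal = T.1 * Matrix.diagonal c * T⁻¹.1 := by
  rw [← h, mul_assoc, ← Units.val_mul, mul_inv_cancel, Units.val_one, mul_one]

theorem det_eq (h : IsDiagonalizedBy T M c) : (M.det : ℂ) = ∏ i, c i := by
  have h1 : ((M.det : ℝ) : ℂ) = (M.map Complex.ofReal).det := RingHom.map_det Complex.ofRealHom M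
  rw [h1, h.map_eq, Matrix.det_mul, Matrix.det_mul, Matrix.det_diagonal, mul_comm, ← mul_assoc,
    ← Matrix.det_mul, ← Units.val_mul, inv_mul_cancel, Units.val_one, Matrix.det_one, one_mul]

theorem inv (h : IsDiagonalizedBy T M c) (hM : IsUnit M.det) (hc : ∀ i, c i ≠ 0) :
    IsDiagonalizedBy T M⁻¹ c⁻¹ := by
  unfold IsDiagonalizedBy at *
  have h1 : M⁻¹.map Complex.ofReal * M.map Complex.ofReal = 1 := by
    rw [← map_ofReal_mul, Matrix.nonsing_inv_mul M hM, map_ofReal_one]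
  have h2 : Matrix.diagonal c * Matrix.diagonal c⁻¹ = 1 := by
    rw [Matrix.diagonal_mul_diagonal, ← Matrix.diagonal_one]
    congr 1
    ext i
    exact mul_inv_cancel₀ (hc i)
  calc M⁻¹.map Complex.ofReal * T.1
      = M⁻¹.map Complex.ofReal * (T.1 * Matrix.diagonal c) * Matrix.diagonal c⁻¹ := by
        rw [mul_assoc, mul_assoc, h2, mul_one]
    _ = _ := by rw [← h, ← mul_assoc, h1, one_mul]

theorem pow (h : IsDiagonalizedBy T M c) (k : ℕ) : IsDiagonalizedBy T (M ^ k) (c ^ k) := by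
  induction k with
  | zero =>
    rw [pow_zero, pow_zero]
    exact one
  | succ k ih =>
    rw [pow_succ, pow_succ]
    exact ih.mul h

theorem zpow (h : IsDiagonalizedBy T M c) (hM : IsUnit M.det) (hc : ∀ i, c i ≠ 0) (k : ℤ) :
    IsDiagonalizedBy T (M ^ k) (c ^ k) := by
  rcases Int.eq_nat_or_neg k with ⟨k, rfl | rfl⟩
  · simpa using h.pow k
  · rw [Matrix.zpow_neg hM, zpow_neg, zpow_natCast, zpow_natCast]
    exact (h.pow k).inv (by rw [Matrix.det_pow]; exact hM.pow k) fun i => pow_ne_zero _ (hc i)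

theorem aeval (h : IsDiagonalizedBy T M c) (f : Polynomial ℝ) :
    IsDiagonalizedBy T (Polynomial.aeval M f) fun i => Polynomial.aeval (c i) f := by
  induction f using Polynomial.induction_on' with
  | add p q hp hq =>
    unfold IsDiagonalizedBy at *
    rw [map_add, Matrix.map_add _ Complex.ofReal_add, add_mul, hp, hq, ← mul_add,
      Matrix.diagonal_add]
    simp only [map_add]
  | monomial k a =>
    have h1 := h.pow k
    unfold IsDiagonalizedBy at *
    simp only [Polynomial.aeval_monomial, ← Algebra.smul_def]
    rw [Matrix.map_smul (R := ℝ) Complex.ofReal a fun x => by simp, Matrix.smul_mul, h1,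
      ← Matrix.mul_smul, ← Matrix.diagonal_smul]
    rfl

theorem norm_le (h : IsDiagonalizedBy T M c) : ‖M‖ ≤ ‖T.1‖ * ‖c‖ * ‖T⁻¹.1‖ := by
  rw [← norm_map_ofReal, h.map_eq]
  refine (norm_mul_le _ _).trans ?_
  gcongr
  refine (norm_mul_le _ _).trans ?_
  rw [Matrix.linfty_opNorm_diagonal]

end IsDiagonalizedBy

end Diagonalization

/-- The minimal polynomial is squarefree, hence separable over `ℝ`, and so remains squarefree over
`ℂ`. The complexification is thus semisimple and its eigenspaces span. -/
theorem exists_isDiagonalizedBy {S : Matrix (Fin n) (Fin n) ℝ}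
    (hS : Module.End.IsSemisimple (Matrix.toLin' S)) :
    ∃ (T : GL (Fin n) ℂ) (c : Fin n → ℂ), IsDiagonalizedBy T S c := by
  set f : Module.End ℂ (Fin n → ℂ) := Matrix.toLinAlgEquiv' (S.map Complex.ofReal) with hf
  have hss : f.IsSemisimple := by
    refine Module.End.isSemisimple_of_squarefree_aeval_eq_zero
      (p := (minpoly ℝ (Matrix.toLin' S)).map Complex.ofRealHom) ?_ ?_
    · exact (PerfectField.separable_iff_squarefree.mpr hS.minpoly_squarefree).map.squarefree
    · have h1 : Polynomial.aeval S (minpoly ℝ (Matrix.toLin' S)) = 0 := by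
        apply Matrix.toLinAlgEquiv'.injective
        rw [map_zero, ← AlgEquiv.coe_toAlgHom, ← Polynomial.aeval_algHom_apply]
        exact minpoly.aeval ℝ (Matrix.toLin' S)
      rw [hf, ← AlgEquiv.coe_toAlgHom, Polynomial.aeval_algHom_apply,
        Polynomial.aeval_def, Polynomial.eval₂_map]
      have h2 := congrArg (Complex.ofRealHom.mapMatrix (m := Fin n)) h1
      rw [Polynomial.aeval_def, Polynomial.hom_eval₂, map_zero] at h2
      have h3 : (algebraMap ℂ (Matrix (Fin n) (Fin n) ℂ)).comp Complex.ofRealHom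
          = (Complex.ofRealHom.mapMatrix (m := Fin n)).comp
            (algebraMap ℝ (Matrix (Fin n) (Fin n) ℝ)) := by
        ext r i j
        by_cases hij : i = j <;> simp [Matrix.algebraMap_matrix_apply, hij]
      rw [h3]
      exact (congrArg _ h2).trans (map_zero _)
  have hint : DirectSum.IsInternal f.eigenspace :=
    DirectSum.isInternal_submodule_of_iSupIndep_of_iSup_eq_top f.eigenspaces_iSupIndep
      hss.iSup_eigenspace_eq_top
  let b := hint.collectedBasis fun μ => Module.finBasis ℂ (f.eigenspace μ)
  let d := Pi.basisFun ℂ (Fin n)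
  let e := b.indexEquiv d
  let b' := b.reindex e
  have hb' : ∀ j, f (b' j) = (e.symm j).1 • b' j := fun j => by
    rw [Module.Basis.reindex_apply]
    exact Module.End.mem_eigenspace_iff.mp (hint.collectedBasis_mem _ (e.symm j))
  refine ⟨⟨d.toMatrix b', b'.toMatrix d, d.toMatrix_mul_toMatrix_flip b',
    b'.toMatrix_mul_toMatrix_flip d⟩, fun j => (e.symm j).1, ?_⟩
  ext i j
  rw [Matrix.mul_diagonal]
  have h : (S.map Complex.ofReal *ᵥ b' j) i = ((e.symm j).1 • b' j) i := congrFun (hb' j) i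
  simp only [Pi.smul_apply, smul_eq_mul, Matrix.mulVec, dotProduct] at h
  rw [Matrix.mul_apply, mul_comm]
  exact h

/-- A real polynomial with prescribed positive powers of the absolute value at given points. -/
theorem exists_polynomial_aeval_eq_norm_rpow (c : Fin n → ℂ) (s : ℝ) :
    ∃ f : Polynomial ℝ, ∀ i, Polynomial.aeval (c i) f = ((‖c i‖ ^ s : ℝ) : ℂ) := by
  let R : Finset ℂ := Finset.univ.image c ∪ Finset.univ.image fun i => starRingEnd ℂ (c i)
  let F : Polynomial ℂ := Lagrange.interpolate R id fun z => ((‖z‖ ^ s : ℝ) : ℂ)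
  have hF : ∀ z ∈ R, F.eval z = ((‖z‖ ^ s : ℝ) : ℂ) := fun z hz =>
    Lagrange.eval_interpolate_at_node _ (Function.injective_id.injOn) hz
  -- The nodes are closed under conjugation and the prescribed values are real and conjugation
  -- invariant. Adding the conjugate polynomial makes the coefficients real and doubles the values.
  let G := F + F.map (starRingEnd ℂ)
  have hG : G ∈ Polynomial.lifts Complex.ofRealHom := by
    rw [Polynomial.lifts_iff_coeff_lifts]
    intro k
    refine ⟨2 * (F.coeff k).re, ?_⟩
    rw [Polynomial.coeff_add, Polynomial.coeff_map, Complex.add_conj]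
    simp
  obtain ⟨g, hg⟩ := (Polynomial.mem_lifts G).mp hG
  refine ⟨Polynomial.C (1 / 2) * g, fun i => ?_⟩
  have h1 : Polynomial.aeval (c i) g = G.eval (c i) := by
    rw [← hg, Polynomial.eval_map]
    rfl
  have h2 : G.eval (c i) = 2 * ((‖c i‖ ^ s : ℝ) : ℂ) := by
    rw [Polynomial.eval_add, hF _ (by simp [R]), Polynomial.eval_map,
      ← Complex.conj_conj (c i), Polynomial.eval₂_hom, hF _ (by simp [R])]
    simp only [Complex.conj_ofReal, RCLike.norm_conj]
    ring
  rw [map_mul, Polynomial.aeval_C, h1, h2]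
  simp

/-! ### Spectra and the multiplicative Jordan–Chevalley decomposition -/

/-- A unit stays a unit after adding a commuting nilpotent, so such a perturbation creates no
spectrum. -/
theorem spectrum.mem_of_mem_add_of_isNilpotent {K R : Type*} [Field K] [Ring R] [Algebra K R]
    {a x : R} (hx : IsNilpotent x) (hc : Commute a x) {z : K} (h : z ∈ spectrum K (a + x)) :
    z ∈ spectrum K a := by
  rw [spectrum.mem_iff] at h ⊢
  contrapose! h
  have hc' : Commute (-x) (algebraMap K R z - a) :=
    ((Algebra.commute_algebraMap_right z (-x)).sub_right hc.symm.neg_left)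
  have := hx.neg.isUnit_add_left_of_commute h hc'
  rwa [show algebraMap K R z - (a + x) = algebraMap K R z - a + -x by abel]

theorem IsNilpotent.map_ofReal {X : Matrix (Fin n) (Fin n) ℝ} (hX : IsNilpotent X) :
    IsNilpotent (X.map Complex.ofReal) :=
  hX.map (Complex.ofRealHom.mapMatrix (m := Fin n))

theorem Commute.map_ofReal {X Y : Matrix (Fin n) (Fin n) ℝ} (h : Commute X Y) :
    Commute (X.map Complex.ofReal) (Y.map Complex.ofReal) :=
  h.map (Complex.ofRealHom.mapMatrix (m := Fin n))

theorem IsDiagonalizedBy.spectrum_eq {T : GL (Fin n) ℂ} {M : Matrix (Fin n) (Fin n) ℝ}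
    {c : Fin n → ℂ} (h : IsDiagonalizedBy T M c) :
    spectrum ℂ (M.map Complex.ofReal) = range c := by
  rw [h.map_eq, spectrum.units_conjugate, spectrum_diagonal]

open Polynomial in
theorem Matrix.exists_charpoly_eq_prod {Q : Matrix (Fin n) (Fin n) ℝ} {P : ℝ → Prop}
    (h : ∀ z ∈ spectrum ℂ (Q.map Complex.ofReal), ∃ r : ℝ, P r ∧ (r : ℂ) = z) :
    ∃ s : Multiset ℝ, (∀ a ∈ s, P a) ∧ Q.charpoly = (s.map fun a => X - C a).prod := by
  have hroots : ∀ z ∈ (Q.map Complex.ofReal).charpoly.roots, ∃ r : ℝ, P r ∧ (r : ℂ) = z :=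
    fun z hz => h z (Matrix.mem_spectrum_of_isRoot_charpoly (isRoot_of_mem_roots hz))
  have hre : ∀ z ∈ (Q.map Complex.ofReal).charpoly.roots, ((z.re : ℝ) : ℂ) = z := fun z hz => by
    obtain ⟨r, -, rfl⟩ := hroots z hz
    simp
  refine ⟨(Q.map Complex.ofReal).charpoly.roots.map Complex.re, fun a ha => ?_, ?_⟩
  · obtain ⟨z, hz, rfl⟩ := Multiset.mem_map.mp ha
    obtain ⟨r, hr, rfl⟩ := hroots z hz
    simpa using hr
  · apply Polynomial.map_injective Complex.ofRealHom Complex.ofReal_injective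
    have h1 : (Q.map Complex.ofReal).charpoly = Q.charpoly.map Complex.ofRealHom :=
      Matrix.charpoly_map Q Complex.ofRealHom
    rw [← h1, Polynomial.map_multiset_prod, Multiset.map_map, Multiset.map_map]
    have h2 := (IsAlgClosed.splits (Q.map Complex.ofReal).charpoly).eq_prod_roots_of_monic
      (Matrix.charpoly_monic _)
    conv_lhs => rw [h2]
    refine congrArg _ (Multiset.map_congr rfl fun z hz => ?_)
    have := hre z hz
    simp [this]

/-- In the additive decomposition the semisimple part `S` is the invertible `A` minus a commuting
nilpotent, hence invertible; dividing the nilpotent part by it gives `N`. -/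
theorem Matrix.exists_isSemisimple_mul_one_add (hA : IsUnit A.det) :
    ∃ S N : Matrix (Fin n) (Fin n) ℝ, Module.End.IsSemisimple (Matrix.toLin' S) ∧
      IsUnit S.det ∧ IsNilpotent N ∧ Commute S N ∧ A = S * (1 + N) := by
  obtain ⟨x, hx, y, hy, hxn, hys, hxy⟩ :=
    Module.End.exists_isNilpotent_isSemisimple (f := Matrix.toLin' A)
  let φ := (Matrix.toLinAlgEquiv' (R := ℝ) (n := Fin n)).symm
  have hcomm : Commute y x := by
    have h1 : Commute (Matrix.toLin' A) x :=
      Algebra.commute_of_mem_adjoin_self hx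
    exact (Algebra.commute_of_mem_adjoin_singleton_of_commute hy h1.symm).symm
  have hA' : A = φ x + φ y := by
    rw [← map_add, ← hxy]
    exact (AlgEquiv.symm_apply_apply Matrix.toLinAlgEquiv' A).symm
  have hnil : IsNilpotent (φ x) := hxn.map φ
  have hc : Commute (φ y) (φ x) := hcomm.map φ
  have hSu : IsUnit (φ y) := by
    have h1 : IsUnit A := (Matrix.isUnit_iff_isUnit_det A).mpr hA
    have h2 : Commute (-φ x) A := by
      rw [hA']
      exact ((Commute.refl _).add_right hc.symm).neg_left
    have := hnil.neg.isUnit_add_left_of_commute h1 h2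
    rwa [hA', add_neg_cancel_comm] at this
  have hSd : IsUnit (φ y).det := (Matrix.isUnit_iff_isUnit_det _).mp hSu
  have hci : Commute (φ y)⁻¹ (φ x) := by
    have := Matrix.Commute.zpow_left hc (-1)
    rwa [Matrix.zpow_neg_one] at this
  refine ⟨φ y, (φ y)⁻¹ * φ x, ?_, hSd, hci.isNilpotent_mul_left hnil, ?_, ?_⟩
  · have : Matrix.toLin' (φ y) = y := AlgEquiv.apply_symm_apply Matrix.toLinAlgEquiv' y
    rwa [this]
  · refine Commute.mul_right ?_ hc
    have := Matrix.Commute.self_zpow (φ y) (-1)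
    rwa [Matrix.zpow_neg_one] at this
  · rw [mul_add, mul_one, ← mul_assoc, Matrix.mul_nonsing_inv _ hSd, one_mul, add_comm]
    exact hA'

/-! ### Reduction to determinant two and positive spectrum -/

/-- A dilation agrees, up to a bounded factor and a change of the exponents, with a matrix of
determinant `2` whose eigenvalues are real and larger than `1`. -/
theorem IsDilation.exists_bounded_zpow_mul_zpow [NeZero n] (hA : IsDilation A) :
    ∃ (Q : Matrix (Fin n) (Fin n) ℝ) (s C : ℝ), Q.det = 2 ∧ 0 < s ∧ |A.det| ^ s = 2 ∧
      (∀ z ∈ spectrum ℂ (Q.map Complex.ofReal), ∃ r : ℝ, 1 < r ∧ (r : ℂ) = z) ∧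
      ∀ a b : ℤ, |a + s * b| ≤ s → ‖A ^ a * Q ^ b‖ ≤ C ∧ ‖Q ^ b * A ^ a‖ ≤ C := by
  have hd := hA.one_lt_abs_det
  obtain ⟨S, N, hSs, hSd, ⟨K, hK⟩, hSN, rfl⟩ := Matrix.exists_isSemisimple_mul_one_add hA.isUnit_det
  obtain ⟨T, c, hT⟩ := exists_isDiagonalizedBy hSs
  have hc : ∀ i, 1 < ‖c i‖ := fun i => by
    have h1 : c i ∈ spectrum ℂ (S.map Complex.ofReal) := by
      rw [hT.spectrum_eq]
      exact mem_range_self i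
    refine hA _ (spectrum.mem_of_mem_add_of_isNilpotent
      (x := (-(S * N)).map Complex.ofReal) ?_ ?_ ?_)
    · exact (hSN.isNilpotent_mul_left ⟨K, hK⟩).neg.map_ofReal
    · refine Commute.map_ofReal (Commute.neg_right ?_)
      exact ((Commute.refl S).mul_right hSN).mul_left
        ((Commute.one_left _).add_left (hSN.symm.mul_right (Commute.refl N)))
    · rw [← Matrix.map_add _ Complex.ofReal_add, mul_add, mul_one, add_neg_cancel_right]
      exact h1
  have hc0 : ∀ i, 0 < ‖c i‖ := fun i => one_pos.trans (hc i)
  have hlogd : 0 < Real.log |(S * (1 + N)).det| := Real.log_pos hd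
  obtain ⟨s, hs0, hds⟩ : ∃ s : ℝ, 0 < s ∧ |(S * (1 + N)).det| ^ s = 2 := by
    refine ⟨Real.log 2 / Real.log |(S * (1 + N)).det|,
      div_pos (Real.log_pos (by norm_num)) hlogd, ?_⟩
    rw [Real.rpow_def_of_pos (one_pos.trans hd), mul_div_cancel₀ _ hlogd.ne',
      Real.exp_log (by norm_num)]
  obtain ⟨f, hf⟩ := exists_polynomial_aeval_eq_norm_rpow c s
  -- `D` plays the role of `|S| ^ s`. Being a real polynomial in `S`, it is a real matrix, commutes
  -- with `S` and `N`, and is diagonalized by the same `T`.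
  set D := Polynomial.aeval S f with hDdef
  have hD : IsDiagonalizedBy T D fun i => ((‖c i‖ ^ s : ℝ) : ℂ) := by
    have := hT.aeval f
    simp only [hf] at this
    exact this
  have hSD : Commute S D := (Commute.refl S).aeval_right f
  have hND : Commute N D := hSN.symm.aeval_right f
  have hdetA : |(S * (1 + N)).det| = ∏ i, ‖c i‖ := by
    rw [Matrix.det_mul, Matrix.det_one_add_of_isNilpotent ⟨K, hK⟩, mul_one, ← Real.norm_eq_abs,
      ← Complex.norm_real, hT.det_eq, norm_prod]
  have hdetD : D.det = 2 := by
    have h1 := hD.det_eq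
    rw [← Complex.ofReal_prod] at h1
    rw [Complex.ofReal_injective h1, Real.finsetProd_rpow _ _ fun i _ => (hc0 i).le, ← hdetA, hds]
  have hDu : IsUnit D.det := by
    rw [hdetD]
    norm_num
  have hUnil := isNilpotent_unipotentPow_sub_one hK s
  have hDU : Commute D (unipotentPow K N s) := commute_unipotentPow hND.symm K s
  have hdetU : (unipotentPow K N s).det = 1 := by
    rw [← Matrix.det_one_add_of_isNilpotent hUnil, add_sub_cancel]
  obtain ⟨C, hC⟩ := exists_norm_unipotentPow_le K N s
  have hcpos : ∀ i, ((‖c i‖ ^ s : ℝ) : ℂ) ≠ 0 := fun i => by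
    exact_mod_cast (Real.rpow_pos_of_pos (hc0 i) s).ne'
  have hbound : ∀ a b : ℤ, |a + s * b| ≤ s →
      ‖(S * (1 + N)) ^ a * (D * unipotentPow K N s) ^ b‖
        ≤ ‖T.1‖ * ‖c‖ ^ s * ‖T⁻¹.1‖ * C := by
    intro a b hab
    -- The unipotent exponents add up to `a + s * b`. The eigenvalues of `S ^ a * D ^ b` likewise
    -- have modulus `‖c i‖ ^ (a + s * b)`, so both factors are bounded.
    have h1 : (S * (1 + N)) ^ a * (D * unipotentPow K N s) ^ b
        = S ^ a * D ^ b * unipotentPow K N (a + s * b) := by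
      have h2 : Commute S (1 + N) := (Commute.one_right S).add_right hSN
      have h3 : Commute (unipotentPow K N (a * 1)) (D ^ b) :=
        (Matrix.Commute.zpow_left (commute_unipotentPow hND.symm K _) b).symm
      rw [Matrix.Commute.mul_zpow h2, Matrix.Commute.mul_zpow hDU, ← unipotentPow_one hK,
        unipotentPow_zpow hK, unipotentPow_zpow hK, mul_assoc, ← mul_assoc _ (D ^ b), h3.eq,
        mul_assoc, mul_assoc, ← unipotentPow_add hK, mul_one, mul_comm (b : ℝ) s]
    rw [h1]
    refine (norm_mul_le _ _).trans ?_
    have h4 := ((hT.zpow hSd (fun i => norm_pos_iff.mp (hc0 i)) a).mul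
      (hD.zpow hDu hcpos b)).norm_le
    have h5 : ‖c ^ a * (fun i => ((‖c i‖ ^ s : ℝ) : ℂ)) ^ b‖ ≤ ‖c‖ ^ s := by
      refine (pi_norm_le_iff_of_nonneg (by positivity)).mpr fun i => ?_
      rw [Pi.mul_apply, Pi.pow_apply, Pi.pow_apply, norm_mul, norm_zpow, norm_zpow,
        Complex.norm_real, Real.norm_of_nonneg (by positivity), ← Real.rpow_intCast,
        ← Real.rpow_intCast, ← Real.rpow_mul (hc0 i).le, ← Real.rpow_add (hc0 i)]
      exact (Real.rpow_le_rpow_of_exponent_le (hc i).le ((le_abs_self _).trans hab)).trans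
        (Real.rpow_le_rpow (hc0 i).le (norm_le_pi_norm c i) hs0.le)
    have hC' := hC _ hab
    gcongr
    exact h4.trans (by gcongr)
  refine ⟨D * unipotentPow K N s, s, _, ?_, hs0, hds, fun z hz => ?_,
    fun a b hab => ⟨hbound a b hab, ?_⟩⟩
  · rw [Matrix.det_mul, hdetD, hdetU, mul_one]
  · have h1 : z ∈ spectrum ℂ (D.map Complex.ofReal) := by
      refine spectrum.mem_of_mem_add_of_isNilpotent
        (x := (D * (unipotentPow K N s - 1)).map Complex.ofReal) ?_ ?_ ?_
      · exact ((hDU.sub_right (Commute.one_right D)).isNilpotent_mul_left hUnil).map_ofReal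
      · exact ((Commute.refl D).mul_right (hDU.sub_right (Commute.one_right D))).map_ofReal
      · rw [← Matrix.map_add _ Complex.ofReal_add, mul_sub, mul_one, add_sub_cancel]
        exact hz
    rw [hD.spectrum_eq] at h1
    obtain ⟨i, rfl⟩ := h1
    exact ⟨_, Real.one_lt_rpow (hc i) hs0, rfl⟩
  · have h2 : Commute (S * (1 + N)) (D * unipotentPow K N s) :=
      (hSD.mul_right (commute_unipotentPow hSN K s)).mul_left
        (((Commute.one_left _).add_left (hND.mul_right
          (commute_unipotentPow (Commute.refl N) K s))))
    rw [← (Matrix.Commute.zpow_zpow h2 a b).eq]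
    exact hbound a b hab

theorem IsDilation.exists_dilationEquivUpToLinear [NeZero n] (hA : IsDilation A) :
    ∃ p : JordanParams n, DilationEquivUpToLinear A p.matrix := by
  obtain ⟨Q, s, C, hQdet, hs0, hds, hQspec, hbound⟩ := hA.exists_bounded_zpow_mul_zpow
  obtain ⟨r, hr, hcp⟩ := Matrix.exists_charpoly_eq_prod hQspec
  obtain ⟨p, S, hS⟩ := exists_jordanParams_mul_eq hr hQdet
    (by rw [← hcp, Matrix.aeval_self_charpoly])
  refine ⟨p, fun ρ σ hρ hσ => ?_⟩
  have hd := hA.one_lt_abs_det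
  have hd0 : 0 < |A.det| := one_pos.trans hd
  have hQu : IsUnit Q.det := by
    rw [hQdet]
    norm_num
  have hpow : ∀ b : ℤ, p.matrix ^ b * S.1 = S.1 * Q ^ b := fun b =>
    (Matrix.SemiconjBy.zpow_right hQu p.isDilation_matrix.isUnit_det hS b).eq.symm
  have hpow' : ∀ b : ℤ, S⁻¹.1 * p.matrix ^ b = Q ^ b * S⁻¹.1 := fun b => by
    have h1 : S⁻¹.1 * S.1 = 1 := by rw [← Units.val_mul, inv_mul_cancel, Units.val_one]
    have h2 : S.1 * S⁻¹.1 = 1 := by rw [← Units.val_mul, mul_inv_cancel, Units.val_one]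
    calc S⁻¹.1 * p.matrix ^ b = S⁻¹.1 * (p.matrix ^ b * S.1) * S⁻¹.1 := by
          rw [mul_assoc, mul_assoc, h2, mul_one]
      _ = _ := by rw [hpow, ← mul_assoc, h1, one_mul]
  -- Since `|A.det| ^ s = 2`, the power `2 ^ m` matches `|A.det| ^ k` when `s * m` is close to `k`;
  -- the floor leaves an error between `0` and `s`, which is exactly the range of the boundedness
  -- statement.
  let m : ℤ → ℤ := fun k => ⌊(k : ℝ) / s⌋
  have hm1 : ∀ k : ℤ, s * m k ≤ k := fun k => by
    rw [mul_comm, ← le_div_iff₀ hs0]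
    exact Int.floor_le _
  have hm2 : ∀ k : ℤ, (k : ℝ) ≤ s * m k + s := fun k => by
    have : (k : ℝ) / s < m k + 1 := Int.lt_floor_add_one _
    rw [div_lt_iff₀ hs0] at this
    linarith
  have hp2 : |p.matrix.det| = 2 := by
    rw [p.det_matrix]
    norm_num
  have h2pow : ∀ b : ℤ, (2 : ℝ) ^ b = |A.det| ^ (s * b) := fun b => by
    rw [Real.rpow_mul hd0.le, hds, Real.rpow_intCast]
  refine hρ.quasiNormEquivUpToLinear_of_bounded hA p.isDilation_matrix hσ S m
    (C := max 2 (max (‖S.1‖ * C) (C * ‖S⁻¹.1‖))) (fun k => ?_) (fun k => ?_) (fun k => ?_)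
    (fun k => ?_)
  · rw [hp2]
    have h1 : |A.det| ^ k ≤ 2 * 2 ^ m k := by
      rw [h2pow, ← Real.rpow_intCast]
      nth_rw 1 [← hds]
      rw [← Real.rpow_add hd0]
      exact Real.rpow_le_rpow_of_exponent_le hd.le (by linarith [hm2 k])
    exact h1.trans (by gcongr; exact le_max_left _ _)
  · rw [hp2]
    have h1 : (2 : ℝ) ^ m k ≤ |A.det| ^ k := by
      rw [h2pow, ← Real.rpow_intCast]
      exact Real.rpow_le_rpow_of_exponent_le hd.le (hm1 k)
    have h2 : (1 : ℝ) ≤ max 2 (max (‖S.1‖ * C) (C * ‖S⁻¹.1‖)) := le_max_of_le_left (by norm_num)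
    exact h1.trans (le_mul_of_one_le_left (by positivity) h2)
  · rw [hpow, mul_assoc]
    refine le_max_of_le_right (le_max_of_le_left ((norm_mul_le _ _).trans ?_))
    gcongr
    refine (hbound k (-m k) ?_).2
    rw [abs_le]
    push_cast
    constructor <;> linarith [hm1 k, hm2 k]
  · rw [mul_assoc, hpow', ← mul_assoc]
    refine le_max_of_le_right (le_max_of_le_right ((norm_mul_le _ _).trans ?_))
    gcongr
    refine (hbound (-k) (m k) ?_).1
    rw [abs_le]
    push_cast
    constructor <;> linarith [hm1 k, hm2 k]

/-! ### Uniqueness and conclusion -/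

theorem JordanParams.eq_of_quasiNormEquivUpToLinear [NeZero n] {p q : JordanParams n}
    {ρ σ : (Fin n → ℝ) → ℝ} (hρ : IsHomogeneousQuasiNorm p.matrix ρ)
    (hσ : IsHomogeneousQuasiNorm q.matrix σ) (h : QuasiNormEquivUpToLinear ρ σ) : p = q := by
  have hp := p.isDilation_matrix
  have hq := q.isDilation_matrix
  obtain ⟨S, C, hC⟩ := h.exists_bounded hp hq (by rw [p.det_matrix, q.det_matrix]) hρ hσ
  obtain ⟨s, hs, hs0⟩ := p.exists_multiset_aeval_matrix_eq_zero
  obtain ⟨t, ht, ht0⟩ := q.exists_multiset_aeval_matrix_eq_zero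
  exact eq_of_mul_matrix_eq S (mul_eq_mul_of_bounded hp.isUnit_det hq.isUnit_det s t hs ht S.1
    (by rw [hs0, mul_zero]) (by rw [ht0, zero_mul]) hC)

theorem corollary4p3 (n : ℕ) (hn : 1 ≤ n) :
    (∀ p : JordanParams n, IsDilation p.matrix) ∧
    (∀ A : Matrix (Fin n) (Fin n) ℝ, IsDilation A →
      (∃ ρ, IsHomogeneousQuasiNorm A ρ) ∧
      ∃! p : JordanParams n, DilationEquivUpToLinear A p.matrix) ∧
    (∀ p q : JordanParams n, p ≠ q →
      ∀ ρ₁ ρ₂ : (Fin n → ℝ) → ℝ,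
        IsHomogeneousQuasiNorm p.matrix ρ₁ → IsHomogeneousQuasiNorm q.matrix ρ₂ →
          ¬ QuasiNormEquivUpToLinear ρ₁ ρ₂) := by
  have : NeZero n := ⟨by omega⟩
  refine ⟨fun p => p.isDilation_matrix, fun A hA => ⟨⟨_, hA.isHomogeneousQuasiNorm_stepQuasiNorm⟩,
    ?_⟩, fun p q hpq ρ₁ ρ₂ h₁ h₂ h => hpq (JordanParams.eq_of_quasiNormEquivUpToLinear h₁ h₂ h)⟩
  obtain ⟨p, hp⟩ := hA.exists_dilationEquivUpToLinear
  refine ⟨p, hp, fun q hq => ?_⟩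
  -- Equivalence of dilations quantifies over all quasi-norms; instantiating it at step quasi-norms
  -- and passing through the one of `A` links the two Jordan matrices.
  have hρ := hA.isHomogeneousQuasiNorm_stepQuasiNorm
  have hσ := p.isDilation_matrix.isHomogeneousQuasiNorm_stepQuasiNorm
  have hτ := q.isDilation_matrix.isHomogeneousQuasiNorm_stepQuasiNorm
  exact JordanParams.eq_of_quasiNormEquivUpToLinear hτ hσ
    ((hq _ _ hρ hτ).symm.trans (hp _ _ hρ hσ))
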